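/- Let $T>0$ and $\mu>0$. Let $H^1_{0,*}(0,T)=\{u\in H^1(0,T): u(0)=0\}$ and $H^1_{*,0}(0,T)=\{v\in H^1(0,T): v(T)=0\}$, both normed by $|u|_{H^1(0,T)}=\|\partial_t u\|_{L^2(0,T)}$, and let $[H^1_{*,0}(0,T)]'$ be the dual of the latter with its dual norm. For $u\in H^1_{0,*}(0,T)$ and $v\in H^1_{*,0}(0,T)$ put $$a(u,v)=-\langle\partial_t u,\partial_t v\rangle_{L^2(0,T)}+\mu\langle u,v\rangle_{L^2(0,T)},$$ and let $\overline{\mathcal H}_T:H^1_{0,*}(0,T)\to H^1_{*,0}(0,T)$ be given by $(\overline{\mathcal H}_T u)(t)=u(T)-u(t)$. Let $N\ge 3$ and let $0=t_1=t_2=t_3<t_4<\dots<t_{N+1}=t_{N+2}=t_{N+3}=T$ be an open knot vector with simple interior knots (not necessarily uniform), with mesh-size $h=\max_{1\le i\le N+2}|t_{i+1}-t_i|$. Let $S^2_h$ be the span of the $N$ quadratic B-splines on $[0,T]$ for these knots (the piecewise quadratic functions of class $C^1$), and let $V^h_{0,*}=S^2_h\cap H^1_{0,*}(0,T)$. Assume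 that $$h\le\frac{\pi^2}{\sqrt2\,(2+\sqrt\mu\,T)\,\mu T}.$$ Then the Galerkin–Bubnov problem $$\text{find } u_h\in V^h_{0,*}\ \text{ such that }\ a(u_h,\overline{\mathcal H}_T v_h)=\langle f,\overline{\mathcal H}_T v_h\rangle\quad\text{for all } v_h\in V^h_{0,*}$$ is well-posed (unique solvability for all data, and an a priori estimate). For every $f\in[H^1_{*,0}(0,T)]'$ its unique solution $u_h$ satisfies $$|u_h|_{H^1(0,T)}\le\frac{(2+\sqrt\mu\,T)^2(\pi^2+4\mu T^2)}{2\pi^2}\,\|f\|_{[H^1_{*,0}(0,T)]'} .$$ Moreover, the continuous problem $a(u,\overline{\mathcal H}_T v)=\langle f,\overline{\mathcal H}_T v\rangle$ for all $v\in H^1_{0,*}(0,T)$ has a unique solution $u\in H^1_{0,*}(0,T)$, and $$|u-u_h|_{H^1(0,T)}\le\left[1+\frac{(2+\sqrt\mu\,T)^2(\pi^2+4\mu T^2)^2}{2\pi^4}\right]\inf_{v_h\in V^h_{0,*}}|u-v_h|_{H^1(0,T)} .$$ -/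

import Mathlib

noncomputable section

namespace IGA

open Set MeasureTheory
open scoped ContDiff

/-! ### Sobolev spaces on `(0,T)` -/

/-- Smooth functions with compact support in the open interval `(0,T)`. -/
structure IsTestFunction (T : ℝ) (φ : ℝ → ℝ) : Prop where
  smooth : ContDiff ℝ ∞ φ
  compact : HasCompactSupport φ
  supp : tsupport φ ⊆ Ioo 0 T

/-- The Hilbert space `L²(0,T)`. -/
abbrev L2 (T : ℝ) : Type := Lp ℝ 2 (volume.restrict (Ioo (0 : ℝ) T))

/-- `g ∈ L²(0,T)` is the weak derivative on `(0,T)` of the function `u : ℝ → ℝ`. -/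
def IsWeakDeriv (T : ℝ) (u : ℝ → ℝ) (g : L2 T) : Prop :=
  ∀ φ : ℝ → ℝ, IsTestFunction T φ →
    ∫ t in Ioo 0 T, u t * deriv φ t = - ∫ t in Ioo 0 T, g t * φ t

lemma integrable_mul_of_continuous {T : ℝ} {u v : ℝ → ℝ} (hu : Continuous u) (hv : Continuous v) :
    IntegrableOn (fun t => u t * v t) (Ioo 0 T) :=
  ((hu.mul hv).integrableOn_Icc (a := 0) (b := T)).mono_set Ioo_subset_Icc_self

lemma IsTestFunction.continuous_deriv {T : ℝ} {φ : ℝ → ℝ} (hφ : IsTestFunction T φ) :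
    Continuous (deriv φ) :=
  hφ.smooth.continuous_deriv (by simp)

lemma integrable_L2_mul {T : ℝ} (g : L2 T) {φ : ℝ → ℝ} (hφ : Continuous φ) :
    IntegrableOn (fun t => g t * φ t) (Ioo 0 T) := by
  have hg : MemLp g 2 (volume.restrict (Ioo (0 : ℝ) T)) := Lp.memLp g
  have h2 : MemLp φ 2 (volume.restrict (Ioo (0 : ℝ) T)) := by
    obtain ⟨C, hC⟩ := (isCompact_Icc (a := (0 : ℝ)) (b := T)).exists_bound_of_continuousOn
      hφ.continuousOn
    refine MemLp.of_bound hφ.aestronglyMeasurable C ?_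
    filter_upwards [ae_restrict_mem measurableSet_Ioo] with t ht
    exact hC t (Ioo_subset_Icc_self ht)
  exact hg.integrable_mul h2

lemma IsWeakDeriv.unique {T : ℝ} {u : ℝ → ℝ} {g₁ g₂ : L2 T} (h₁ : IsWeakDeriv T u g₁)
    (h₂ : IsWeakDeriv T u g₂) : g₁ = g₂ := by
  have hint : Integrable (fun t => g₁ t - g₂ t) (volume.restrict (Ioo (0 : ℝ) T)) :=
    ((Lp.memLp g₁).integrable (by norm_num)).sub ((Lp.memLp g₂).integrable (by norm_num))
  have key := isOpen_Ioo.ae_eq_zero_of_integral_contDiff_smul_eq_zero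
    (f := fun t => g₁ t - g₂ t) (μ := volume.restrict (Ioo (0 : ℝ) T)) (U := Ioo (0 : ℝ) T)
    (hint.locallyIntegrable.locallyIntegrableOn _) (by
      intro φ h h' h''
      have hφ : IsTestFunction T φ := ⟨h, h', h''⟩
      have e := neg_injective ((h₁ φ hφ).symm.trans (h₂ φ hφ))
      have : (fun t => φ t • (g₁ t - g₂ t)) = fun t => g₁ t * φ t - g₂ t * φ t := by
        funext t; simp only [smul_eq_mul]; ring
      rw [this, integral_sub (integrable_L2_mul g₁ h.continuous)
        (integrable_L2_mul g₂ h.continuous), e, sub_self])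
  refine Lp.ext ?_
  filter_upwards [key, ae_restrict_mem measurableSet_Ioo] with t ht hm
  exact sub_eq_zero.1 (ht hm)

variable (T : ℝ) [hT : Fact (0 < T)]

/-- A continuous function on `[0,T]`, extended to the real line by constants. -/
abbrev ext (u : C(Icc (0 : ℝ) T, ℝ)) : ℝ → ℝ := IccExtend hT.out.le u

/-- The left endpoint `0` of `[0,T]`. -/
def left : Icc (0 : ℝ) T := ⟨0, left_mem_Icc.2 hT.out.le⟩

/-- The right endpoint `T` of `[0,T]`. -/
def right : Icc (0 : ℝ) T := ⟨T, right_mem_Icc.2 hT.out.le⟩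

variable {T}

lemma continuous_ext (u : C(Icc (0 : ℝ) T, ℝ)) : Continuous (ext T u) :=
  u.continuous.Icc_extend'

lemma IsTestFunction.integral_deriv_eq_zero {φ : ℝ → ℝ} (hφ : IsTestFunction T φ) :
    ∫ t in Ioo 0 T, deriv φ t = 0 := by
  have h0 : φ 0 = 0 := image_eq_zero_of_notMem_tsupport fun h => lt_irrefl _ (hφ.supp h).1
  have h1 : φ T = 0 := image_eq_zero_of_notMem_tsupport fun h => lt_irrefl _ (hφ.supp h).2
  rw [← integral_Ioc_eq_integral_Ioo, ← intervalIntegral.integral_of_le hT.out.le,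
    intervalIntegral.integral_deriv_eq_sub
      (fun x _ => (hφ.smooth.differentiable (by simp)).differentiableAt)
      (hφ.continuous_deriv.intervalIntegrable _ _), h0, h1, sub_zero]

lemma IsWeakDeriv.add {u v : C(Icc (0 : ℝ) T, ℝ)} {g k : L2 T} (hu : IsWeakDeriv T (ext T u) g)
    (hv : IsWeakDeriv T (ext T v) k) : IsWeakDeriv T (ext T (u + v)) (g + k) := by
  intro φ hφ
  have e1 : (fun t => ext T (u + v) t * deriv φ t)
      = fun t => ext T u t * deriv φ t + ext T v t * deriv φ t := by
    funext t; simp only [ext, IccExtend, Function.comp, ContinuousMap.add_apply]; ring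
  have e2 : ∫ t in Ioo 0 T, (g + k : L2 T) t * φ t
      = ∫ t in Ioo 0 T, (g t * φ t + k t * φ t) := by
    refine integral_congr_ae ?_
    filter_upwards [Lp.coeFn_add g k] with t ht
    rw [ht, Pi.add_apply, add_mul]
  rw [e1, e2, integral_add (integrable_mul_of_continuous (continuous_ext u) hφ.continuous_deriv)
    (integrable_mul_of_continuous (continuous_ext v) hφ.continuous_deriv),
    integral_add (integrable_L2_mul g hφ.smooth.continuous)
      (integrable_L2_mul k hφ.smooth.continuous), hu φ hφ, hv φ hφ]
  ring

lemma IsWeakDeriv.smul {u : C(Icc (0 : ℝ) T, ℝ)} {g : L2 T} (c : ℝ)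
    (hu : IsWeakDeriv T (ext T u) g) : IsWeakDeriv T (ext T (c • u)) (c • g) := by
  intro φ hφ
  have e1 : (fun t => ext T (c • u) t * deriv φ t) = fun t => c * (ext T u t * deriv φ t) := by
    funext t
    simp only [ext, IccExtend, Function.comp, ContinuousMap.smul_apply, smul_eq_mul]; ring
  have e2 : ∫ t in Ioo 0 T, (c • g : L2 T) t * φ t = ∫ t in Ioo 0 T, c * (g t * φ t) := by
    refine integral_congr_ae ?_
    filter_upwards [Lp.coeFn_smul c g] with t ht
    rw [ht, Pi.smul_apply, smul_eq_mul, mul_assoc]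
  rw [e1, e2, integral_const_mul, integral_const_mul, hu φ hφ]
  ring

lemma isWeakDeriv_const (c : ℝ) :
    IsWeakDeriv T (ext T (ContinuousMap.const _ c)) (0 : L2 T) := by
  intro φ hφ
  have e1 : (fun t => ext T (ContinuousMap.const _ c) t * deriv φ t)
      = fun t => c * deriv φ t := by
    funext t; simp [ext, IccExtend]
  have e2 : ∫ t in Ioo 0 T, (0 : L2 T) t * φ t = ∫ t in Ioo 0 T, (0 : ℝ) := by
    refine integral_congr_ae ?_
    filter_upwards [Lp.coeFn_zero ℝ 2 (volume.restrict (Ioo (0 : ℝ) T))] with t ht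
    rw [ht, Pi.zero_apply, zero_mul]
  rw [e1, e2, integral_const_mul, hφ.integral_deriv_eq_zero]
  simp

variable (T)

/-- The Sobolev space `H¹(0,T)`: the functions with a weak derivative in `L²(0,T)`. Every class in
`H¹(0,T)` has exactly one representative that is continuous on `[0,T]`, and that representative is
the element used here; so the values `u(0)` and `u(T)` are the values of the function. -/
def H1 : Submodule ℝ C(Icc (0 : ℝ) T, ℝ) where
  carrier := {u | ∃ g : L2 T, IsWeakDeriv T (ext T u) g}
  zero_mem' := ⟨0, isWeakDeriv_const 0⟩
  add_mem' := fun ⟨g, hg⟩ ⟨k, hk⟩ => ⟨g + k, hg.add hk⟩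
  smul_mem' := fun c _ ⟨g, hg⟩ => ⟨c • g, hg.smul c⟩

/-- The weak derivative `∂ₜ u ∈ L²(0,T)` of `u ∈ H¹(0,T)`. -/
def weakDeriv : H1 T →ₗ[ℝ] L2 T where
  toFun u := u.2.choose
  map_add' u v := (u + v).2.choose_spec.unique (u.2.choose_spec.add v.2.choose_spec)
  map_smul' c u := (c • u).2.choose_spec.unique (u.2.choose_spec.smul c)

variable {T}

lemma weakDeriv_spec (u : H1 T) : IsWeakDeriv T (ext T u.1) (weakDeriv T u) :=
  u.2.choose_spec

lemma weakDeriv_eq_of_isWeakDeriv (u : H1 T) {g : L2 T} (h : IsWeakDeriv T (ext T u.1) g) :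
    weakDeriv T u = g :=
  (weakDeriv_spec u).unique h

/-- Antiderivatives of test functions with zero mean are test functions. -/
lemma exists_antideriv {ψ : ℝ → ℝ} (hψ : IsTestFunction T ψ)
    (h0 : ∫ t in Ioo 0 T, ψ t = 0) : ∃ Ψ, IsTestFunction T Ψ ∧ deriv Ψ = ψ := by
  have hc : Continuous ψ := hψ.smooth.continuous
  have hd : ∀ x, HasDerivAt (fun x => ∫ t in (0 : ℝ)..x, ψ t) (ψ x) x := fun x =>
    intervalIntegral.integral_hasDerivAt_right (hc.intervalIntegrable _ _)
      (hc.stronglyMeasurableAtFilter _ _) hc.continuousAt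
  have hde : deriv (fun x => ∫ t in (0 : ℝ)..x, ψ t) = ψ := funext fun x => (hd x).deriv
  have hT0 : ∫ t in (0 : ℝ)..T, ψ t = 0 := by
    rw [intervalIntegral.integral_of_le hT.out.le, integral_Ioc_eq_integral_Ioo, h0]
  obtain ⟨a, b, ha, hb, hab⟩ : ∃ a b : ℝ, 0 < a ∧ b < T ∧ tsupport ψ ⊆ Icc a b := by
    rcases (tsupport ψ).eq_empty_or_nonempty with he | hne
    · exact ⟨T, 0, hT.out, hT.out, by simp [he]⟩
    · have hK : IsCompact (tsupport ψ) := hψ.compact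
      refine ⟨sInf (tsupport ψ), sSup (tsupport ψ), (hψ.supp (hK.sInf_mem hne)).1,
        (hψ.supp (hK.sSup_mem hne)).2, fun x hx => ⟨csInf_le hK.bddBelow hx,
        le_csSup hK.bddAbove hx⟩⟩
  have hz : ∀ t, t ∉ Icc a b → ψ t = 0 := fun t ht =>
    image_eq_zero_of_notMem_tsupport fun h => ht (hab h)
  have hsupp : Function.support (fun x => ∫ t in (0 : ℝ)..x, ψ t) ⊆ Icc a b := by
    intro x hx
    by_contra hnot
    apply hx
    rcases not_and_or.1 hnot with h | h
    · push Not at h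
      refine (intervalIntegral.integral_congr (g := fun _ => 0) fun t ht => ?_).trans (by simp)
      refine hz t fun hm => ?_
      rcases le_total 0 x with h' | h'
      · rw [uIcc_of_le h'] at ht; linarith [ht.2, hm.1]
      · rw [uIcc_of_ge h'] at ht; linarith [ht.2, hm.1]
    · push Not at h
      have hadd := intervalIntegral.integral_add_adjacent_intervals (μ := volume)
        (hc.intervalIntegrable 0 T) (hc.intervalIntegrable T x)
      have : ∫ t in T..x, ψ t = 0 := by
        refine (intervalIntegral.integral_congr (g := fun _ => 0) fun t ht => ?_).trans (by simp)
        refine hz t fun hm => ?_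
        rcases le_total T x with h' | h'
        · rw [uIcc_of_le h'] at ht; linarith [ht.1, hm.2]
        · rw [uIcc_of_ge h'] at ht; linarith [ht.1, hm.2]
      show ∫ t in (0 : ℝ)..x, ψ t = 0
      rw [← hadd, hT0, this, add_zero]
  have hts : tsupport (fun x => ∫ t in (0 : ℝ)..x, ψ t) ⊆ Icc a b :=
    closure_minimal hsupp isClosed_Icc
  refine ⟨_, ⟨?_, ?_, ?_⟩, hde⟩
  · rw [contDiff_infty_iff_deriv]
    exact ⟨fun x => (hd x).differentiableAt, by rw [hde]; exact hψ.smooth⟩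
  · exact HasCompactSupport.of_support_subset_isCompact isCompact_Icc hsupp
  · exact hts.trans fun x hx => ⟨ha.trans_le hx.1, hx.2.trans_lt hb⟩

/-- A function with vanishing weak derivative is constant. -/
lemma eq_of_weakDeriv_eq_zero (u : H1 T) (hu : weakDeriv T u = 0) :
    ∃ c : ℝ, ∀ t, u.1 t = c := by
  have hw : ∀ φ, IsTestFunction T φ → ∫ t in Ioo 0 T, ext T u.1 t * deriv φ t = 0 := by
    intro φ hφ
    rw [weakDeriv_spec u φ hφ, hu]
    rw [integral_congr_ae (g := fun _ => (0 : ℝ)), integral_zero, neg_zero]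
    filter_upwards [Lp.coeFn_zero ℝ 2 (volume.restrict (Ioo (0 : ℝ) T))] with t ht
    rw [ht, Pi.zero_apply, zero_mul]
  have hpos := hT.out
  let b : ContDiffBump (T / 2) := ⟨T / 8, T / 4, by positivity, by linarith⟩
  have hbs : tsupport b ⊆ Ioo 0 T := by
    rw [b.tsupport_eq, Real.closedBall_eq_Icc]
    intro x hx
    have h1 : T / 2 - T / 4 ≤ x := hx.1
    have h2 : x ≤ T / 2 + T / 4 := hx.2
    constructor <;> linarith
  have hχ : IsTestFunction T (b.normed volume) :=
    ⟨b.contDiff_normed, b.hasCompactSupport_normed, by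
      rw [b.tsupport_normed_eq, ← b.tsupport_eq]; exact hbs⟩
  have hχ1 : ∫ t in Ioo 0 T, b.normed volume t = 1 := by
    rw [setIntegral_eq_integral_of_forall_compl_eq_zero, b.integral_normed]
    exact fun x hx => image_eq_zero_of_notMem_tsupport fun h => hx (hχ.supp h)
  set χ := b.normed volume with hχdef
  set c := ∫ t in Ioo 0 T, ext T u.1 t * χ t with hc
  have hint : ∀ {f : ℝ → ℝ}, Continuous f → IntegrableOn f (Ioo 0 T) := fun hf =>
    (hf.integrableOn_Icc (a := 0) (b := T)).mono_set Ioo_subset_Icc_self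
  have key := isOpen_Ioo.ae_eq_zero_of_integral_contDiff_smul_eq_zero
    (f := fun t => ext T u.1 t - c) (μ := volume.restrict (Ioo (0 : ℝ) T)) (U := Ioo (0 : ℝ) T)
    (((continuous_ext u.1).sub continuous_const).locallyIntegrable.locallyIntegrableOn _) (by
      intro φ h h' h''
      set m := ∫ t in Ioo 0 T, φ t with hm
      have hψ : IsTestFunction T (fun t => φ t - m * χ t) := by
        have hs : Function.support (fun t => φ t - m * χ t) ⊆ tsupport φ ∪ tsupport χ := by
          intro t ht
          by_contra hn
          rw [mem_union, not_or] at hn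
          exact ht (by simp [image_eq_zero_of_notMem_tsupport hn.1,
            image_eq_zero_of_notMem_tsupport hn.2])
        refine ⟨h.sub (contDiff_const.mul hχ.smooth),
          HasCompactSupport.of_support_subset_isCompact (h'.isCompact.union hχ.compact.isCompact) hs,
          (closure_minimal hs ((isClosed_tsupport _).union (isClosed_tsupport _))).trans
            (union_subset h'' hχ.supp)⟩
      have hχc := hχ.smooth.continuous
      have hψ0 : ∫ t in Ioo 0 T, (φ t - m * χ t) = 0 := by
        have i2 : IntegrableOn (fun t => m * χ t) (Ioo 0 T) := hint (continuous_const.mul hχc)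
        rw [integral_sub (hint h.continuous) i2, integral_const_mul, hχ1, mul_one, ← hm, sub_self]
      obtain ⟨Ψ, hΨ, hΨ'⟩ := exists_antideriv hψ hψ0
      have h3 := hw Ψ hΨ
      rw [hΨ'] at h3
      have hcu := continuous_ext u.1
      have e1 : (fun t => ext T u.1 t * (φ t - m * χ t))
          = fun t => ext T u.1 t * φ t - m * (ext T u.1 t * χ t) := by funext t; ring
      have i1 : IntegrableOn (fun t => ext T u.1 t * φ t) (Ioo 0 T) :=
        hint (hcu.mul h.continuous)
      have i2 : IntegrableOn (fun t => m * (ext T u.1 t * χ t)) (Ioo 0 T) :=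
        hint (continuous_const.mul (hcu.mul hχc))
      have i3 : IntegrableOn (fun t => c * φ t) (Ioo 0 T) :=
        hint (continuous_const.mul h.continuous)
      rw [e1, integral_sub i1 i2, integral_const_mul, ← hc] at h3
      have e2 : (fun t => φ t • (ext T u.1 t - c))
          = fun t => ext T u.1 t * φ t - c * φ t := by
        funext t; simp only [smul_eq_mul]; ring
      rw [e2, integral_sub i1 i3, integral_const_mul, ← hm]
      linarith)
  have hae : ext T u.1 =ᵐ[volume.restrict (Icc (0 : ℝ) T)] fun _ => c := by
    rw [Measure.restrict_congr_set Ioo_ae_eq_Icc.symm]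
    filter_upwards [key, ae_restrict_mem measurableSet_Ioo] with t ht hm
    exact sub_eq_zero.1 (ht hm)
  have heq := Measure.eqOn_Icc_of_ae_eq volume hpos.ne hae (continuous_ext u.1).continuousOn
    continuousOn_const
  refine ⟨c, fun t => ?_⟩
  have h := heq t.2
  rwa [ext, IccExtend_val] at h

variable (T)

/-- The functions of `H¹(0,T)` that vanish at `0`, as a subspace. -/
def leftSubmodule : Submodule ℝ (H1 T) where
  carrier := {u | u.1 (left T) = 0}
  zero_mem' := rfl
  add_mem' := fun {u v} hu hv => by
    show u.1 (left T) + v.1 (left T) = 0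
    rw [show u.1 (left T) = 0 from hu, show v.1 (left T) = 0 from hv, add_zero]
  smul_mem' := fun c u hu => by
    show c * u.1 (left T) = 0
    rw [show u.1 (left T) = 0 from hu, mul_zero]

/-- The functions of `H¹(0,T)` that vanish at `T`, as a subspace. -/
def rightSubmodule : Submodule ℝ (H1 T) where
  carrier := {u | u.1 (right T) = 0}
  zero_mem' := rfl
  add_mem' := fun {u v} hu hv => by
    show u.1 (right T) + v.1 (right T) = 0
    rw [show u.1 (right T) = 0 from hu, show v.1 (right T) = 0 from hv, add_zero]
  smul_mem' := fun c u hu => by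
    show c * u.1 (right T) = 0
    rw [show u.1 (right T) = 0 from hu, mul_zero]

/-- The space `H¹_{0,*}(0,T)` of the functions of `H¹(0,T)` that vanish at `0`. -/
def H1Left : Type := leftSubmodule T

/-- The space `H¹_{*,0}(0,T)` of the functions of `H¹(0,T)` that vanish at `T`. -/
def H1Right : Type := rightSubmodule T

instance : AddCommGroup (H1Left T) := inferInstanceAs (AddCommGroup (leftSubmodule T))
instance : AddCommGroup (H1Right T) := inferInstanceAs (AddCommGroup (rightSubmodule T))
instance : Module ℝ (H1Left T) := inferInstanceAs (Module ℝ (leftSubmodule T))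
instance : Module ℝ (H1Right T) := inferInstanceAs (Module ℝ (rightSubmodule T))

/-- The inclusion of `H¹_{0,*}(0,T)` in `H¹(0,T)`. -/
def H1Left.incl : H1Left T →ₗ[ℝ] H1 T := (leftSubmodule T).subtype

/-- The inclusion of `H¹_{*,0}(0,T)` in `H¹(0,T)`. -/
def H1Right.incl : H1Right T →ₗ[ℝ] H1 T := (rightSubmodule T).subtype

/-- The weak derivative on `H¹_{0,*}(0,T)`. -/
def H1Left.deriv : H1Left T →ₗ[ℝ] L2 T := weakDeriv T ∘ₗ H1Left.incl T

/-- The weak derivative on `H¹_{*,0}(0,T)`. -/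
def H1Right.deriv : H1Right T →ₗ[ℝ] L2 T := weakDeriv T ∘ₗ H1Right.incl T

/-- The inclusion of `H¹_{0,*}(0,T)` in the functions on `[0,T]`. -/
def H1Left.toFun : H1Left T →ₗ[ℝ] (Icc (0 : ℝ) T → ℝ) :=
  ContinuousMap.coeFnLinearMap ℝ ∘ₗ (H1 T).subtype ∘ₗ H1Left.incl T

lemma H1Left.deriv_injective : Function.Injective (H1Left.deriv T) := by
  refine (injective_iff_map_eq_zero _).2 fun u hu => ?_
  obtain ⟨c, hc⟩ := eq_of_weakDeriv_eq_zero (H1Left.incl T u) hu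
  have h0 : (H1Left.incl T u).1 (left T) = 0 := u.2
  refine Subtype.ext (Subtype.ext (ContinuousMap.ext fun t => ?_))
  exact (hc t).trans ((hc _).symm.trans h0)

lemma H1Right.deriv_injective : Function.Injective (H1Right.deriv T) := by
  refine (injective_iff_map_eq_zero _).2 fun u hu => ?_
  obtain ⟨c, hc⟩ := eq_of_weakDeriv_eq_zero (H1Right.incl T u) hu
  have h0 : (H1Right.incl T u).1 (right T) = 0 := u.2
  refine Subtype.ext (Subtype.ext (ContinuousMap.ext fun t => ?_))
  exact (hc t).trans ((hc _).symm.trans h0)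

/-- `H¹_{0,*}(0,T)` is normed by `|u|_{H¹(0,T)} = ‖∂ₜ u‖_{L²(0,T)}`. -/
instance : NormedAddCommGroup (H1Left T) :=
  NormedAddCommGroup.induced (H1Left T) (L2 T) (H1Left.deriv T) (H1Left.deriv_injective T)

/-- `H¹_{*,0}(0,T)` is normed by `|v|_{H¹(0,T)} = ‖∂ₜ v‖_{L²(0,T)}`. -/
instance : NormedAddCommGroup (H1Right T) :=
  NormedAddCommGroup.induced (H1Right T) (L2 T) (H1Right.deriv T) (H1Right.deriv_injective T)

instance : NormedSpace ℝ (H1Left T) := NormedSpace.induced ℝ (H1Left T) (L2 T) (H1Left.deriv T)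
instance : NormedSpace ℝ (H1Right T) := NormedSpace.induced ℝ (H1Right T) (L2 T) (H1Right.deriv T)

lemma H1Left.norm_def (u : H1Left T) : ‖u‖ = ‖H1Left.deriv T u‖ := rfl

lemma H1Right.norm_def (v : H1Right T) : ‖v‖ = ‖H1Right.deriv T v‖ := rfl

/-! ### The variational problem -/

/-- The inner product `⟨u,v⟩_{L²(0,T)}` on `H¹(0,T)`. -/
def l2Form : H1 T →ₗ[ℝ] H1 T →ₗ[ℝ] ℝ :=
  LinearMap.mk₂ ℝ (fun u v => ∫ t in Ioo 0 T, ext T u.1 t * ext T v.1 t)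
    (fun u u' v => by
      rw [← integral_add (integrable_mul_of_continuous (continuous_ext _) (continuous_ext _))
        (integrable_mul_of_continuous (continuous_ext _) (continuous_ext _))]
      refine integral_congr_ae (Filter.Eventually.of_forall fun t => ?_)
      simp only [ext, IccExtend, Function.comp, Submodule.coe_add, ContinuousMap.add_apply]
      ring)
    (fun c u v => by
      rw [smul_eq_mul, ← integral_const_mul]
      refine integral_congr_ae (Filter.Eventually.of_forall fun t => ?_)
      simp only [ext, IccExtend, Function.comp, Submodule.coe_smul, ContinuousMap.smul_apply,
        smul_eq_mul]
      ring)
    (fun u v v' => by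
      rw [← integral_add (integrable_mul_of_continuous (continuous_ext _) (continuous_ext _))
        (integrable_mul_of_continuous (continuous_ext _) (continuous_ext _))]
      refine integral_congr_ae (Filter.Eventually.of_forall fun t => ?_)
      simp only [ext, IccExtend, Function.comp, Submodule.coe_add, ContinuousMap.add_apply]
      ring)
    (fun c u v => by
      rw [smul_eq_mul, ← integral_const_mul]
      refine integral_congr_ae (Filter.Eventually.of_forall fun t => ?_)
      simp only [ext, IccExtend, Function.comp, Submodule.coe_smul, ContinuousMap.smul_apply,
        smul_eq_mul]
      ring)

/-- The bilinear form `a(u,v) = -⟨∂ₜ u, ∂ₜ v⟩_{L²(0,T)} + μ ⟨u,v⟩_{L²(0,T)}` on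
`H¹_{0,*}(0,T) × H¹_{*,0}(0,T)`. -/
def a (μ : ℝ) : H1Left T →ₗ[ℝ] H1Right T →ₗ[ℝ] ℝ :=
  -((innerₗ (L2 T)).compl₁₂ (H1Left.deriv T) (H1Right.deriv T))
    + μ • (l2Form T).compl₁₂ (H1Left.incl T) (H1Right.incl T)

lemma a_apply (μ : ℝ) (u : H1Left T) (v : H1Right T) :
    a T μ u v = -(inner ℝ (H1Left.deriv T u) (H1Right.deriv T v))
      + μ * ∫ t in Ioo 0 T, ext T (H1Left.incl T u).1 t * ext T (H1Right.incl T v).1 t := rfl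

/-- The map `H_T : H¹_{0,*}(0,T) → H¹_{*,0}(0,T)`, `(H_T u)(t) = u(T) - u(t)`. -/
def HT : H1Left T →ₗ[ℝ] H1Right T where
  toFun u := ⟨⟨ContinuousMap.const _ ((H1Left.incl T u).1 (right T)), 0, isWeakDeriv_const _⟩
      - H1Left.incl T u, sub_self _⟩
  map_add' u v := by
    refine Subtype.ext (Subtype.ext (ContinuousMap.ext fun t => ?_))
    exact add_sub_add_comm _ _ _ _
  map_smul' c u := by
    refine Subtype.ext (Subtype.ext (ContinuousMap.ext fun t => ?_))
    exact (mul_sub _ _ _).symm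

lemma HT_apply (u : H1Left T) (t : Icc (0 : ℝ) T) :
    (H1Right.incl T (HT T u)).1 t = (H1Left.incl T u).1 (right T) - (H1Left.incl T u).1 t := rfl

/-- The bilinear form `(u,v) ↦ a(u, H_T v)` on `H¹_{0,*}(0,T) × H¹_{0,*}(0,T)`. -/
def aHT (μ : ℝ) : H1Left T →ₗ[ℝ] H1Left T →ₗ[ℝ] ℝ := (a T μ).compl₂ (HT T)

/-- `u` solves the continuous problem
`u ∈ H¹_{0,*}(0,T)`, `a(u, H_T v) = ⟨f, H_T v⟩` for all `v ∈ H¹_{0,*}(0,T)`. -/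
def IsSolution (μ : ℝ) (f : StrongDual ℝ (H1Right T)) (u : H1Left T) : Prop :=
  ∀ v : H1Left T, a T μ u (HT T v) = f (HT T v)

/-- `u` solves the Galerkin-Bubnov discretization
`u ∈ V`, `a(u, H_T v) = ⟨f, H_T v⟩` for all `v ∈ V`, in a subspace `V` of `H¹_{0,*}(0,T)`. -/
def IsGalerkinSolution (μ : ℝ) (V : Submodule ℝ (H1Left T)) (f : StrongDual ℝ (H1Right T))
    (u : V) : Prop :=
  ∀ v : V, a T μ u (HT T v) = f (HT T v)

/-- Well-posedness in the sense of Hadamard of the abstract problem "find `u ∈ W` with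
`b(u,v) = ⟨F,v⟩` for all `v ∈ V`": existence and uniqueness for every `F ∈ V'`, together with an
a priori estimate. -/
def WellPosed {W V : Type*} [NormedAddCommGroup W] [NormedSpace ℝ W] [NormedAddCommGroup V]
    [NormedSpace ℝ V] (b : W →ₗ[ℝ] V →ₗ[ℝ] ℝ) : Prop :=
  (∀ F : StrongDual ℝ V, ∃! u : W, ∀ v : V, b u v = F v) ∧
    ∃ C : ℝ, 0 < C ∧ ∀ (F : StrongDual ℝ V) (u : W), (∀ v : V, b u v = F v) → ‖u‖ ≤ C * ‖F‖

/-! ### Spline spaces -/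

section Spline

/-- The B-spline `b_{j,p}` over the knots `ξ`, by the Cox-de Boor recursion; a quotient with
denominator `0` is `0`. -/
def coxDeBoor (ξ : ℕ → ℝ) : ℕ → ℕ → ℝ → ℝ
  | 0, j, x => open Classical in if x ∈ Ico (ξ j) (ξ (j + 1)) then 1 else 0
  | p + 1, j, x => open Classical in
      if x ∈ Ico (ξ j) (ξ (j + p + 2)) then
        (x - ξ j) / (ξ (j + p + 1) - ξ j) * coxDeBoor ξ p j x
          + (ξ (j + p + 2) - x) / (ξ (j + p + 2) - ξ (j + 1)) * coxDeBoor ξ p (j + 1) x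
      else 0

/-- The `j`-th B-spline of degree `p` on `[0,T]`; its value at the right endpoint `T` is the limit
from the left. -/
def bSpline (T : ℝ) (ξ : ℕ → ℝ) (p j : ℕ) (x : Icc (0 : ℝ) T) : ℝ :=
  open Classical in
  if (x : ℝ) = T then Function.leftLim (coxDeBoor ξ p j) T else coxDeBoor ξ p j x

/-- The numbers `ξ 1, …, ξ (N + 3)` form an open knot vector on `[0,T]` for quadratic splines with
simple interior knots: `0 = ξ₁ = ξ₂ = ξ₃ < ξ₄ < … < ξ_{N+1} = ξ_{N+2} = ξ_{N+3} = T`.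
The other values of `ξ` play no role. -/
structure IsOpenKnotVector (T : ℝ) (N : ℕ) (ξ : ℕ → ℝ) : Prop where
  one : ξ 1 = 0
  two : ξ 2 = 0
  three : ξ 3 = 0
  strictMono : StrictMonoOn ξ (Icc 3 (N + 1))
  last₁ : ξ (N + 1) = T
  last₂ : ξ (N + 2) = T
  last₃ : ξ (N + 3) = T

/-- The mesh-size `h = max {|ξ_{i+1} - ξ_i| : i = 1, …, N + 2}`. -/
def meshSize (N : ℕ) (ξ : ℕ → ℝ) : ℝ :=
  (Finset.Icc 1 (N + 2)).sup' ⟨1, by simp⟩ fun i => |ξ (i + 1) - ξ i|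

/-- The quadratic spline space `S²_h = span {b_{i,2} : i = 1, …, N}` on `[0,T]`. -/
def splineSpace (T : ℝ) (N : ℕ) (ξ : ℕ → ℝ) : Submodule ℝ (Icc (0 : ℝ) T → ℝ) :=
  Submodule.span ℝ (bSpline T ξ 2 '' Icc 1 N)

end Spline

/-- The isogeometric space `V^h_{0,*} = S²_h ∩ H¹_{0,*}(0,T)`. -/
def splineLeft (N : ℕ) (ξ : ℕ → ℝ) : Submodule ℝ (H1Left T) :=
  (splineSpace T N ξ).comap (H1Left.toFun T)

/-- The bilinear form `(u,v) ↦ a(u, H_T v)` on `V^h_{0,*} × V^h_{0,*}`. -/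
def galerkinForm (μ : ℝ) (V : Submodule ℝ (H1Left T)) : V →ₗ[ℝ] V →ₗ[ℝ] ℝ :=
  (aHT T μ).compl₁₂ V.subtype V.subtype

end IGA

end

/-!
The derivative identifies `H¹_{0,*}(0,T)` isometrically with `L²(0,T)` (`derivEquiv`). Let `J` be the
primitive operator `(J g)(t) = ∫₀ᵗ g`. Integration by parts turns the form `a(u, H_T v)` into
`⟨A ∂ₜu, ∂ₜv⟩` with `A = 1 + μ J²` (`a_HT`), and `f(H_T v)` into `⟨F, ∂ₜv⟩` by Riesz, so that the
continuous problem is the equation `A ∂ₜu = F`, that is, `U'' + μ U = F`, `U(0) = U'(0) = 0` for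
`U = J u`. Variation of constants solves it (`opA_surjective`), and Duhamel's formula with the
Cauchy–Schwarz inequality gives `‖A⁻¹‖ ≤ L := 1 + √μ T / 2` (`norm_le_opA`).

The discrete problem is treated by duality. Given `g` in the space `W` of derivatives of splines,
let `v` solve the adjoint problem `⟨A w, v⟩ = ⟨w, g⟩` for all `w`, and test with the orthogonal
projection `P v` onto `W`. As `A - 1 = μ J²` and `v - P v ⟂ W`,
`⟨A g, P v⟩ = ‖g‖² - μ ⟨J² g - k, v - P v⟩` for each `k ∈ W`. If `J² g` is approximated from `W` up
to `ε ‖g‖`, this is at least `(1 - μ ε L) ‖g‖²` (`exists_discrete_infSup`), a discrete inf-sup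
condition with stability constant `L / (1 - μ ε L)`.

For quadratic splines `W` contains all continuous piecewise linear functions: their primitives have
explicit B-spline coefficients, given by polar forms (`primLeft_plL2_mem`). The piecewise linear
interpolant of `J² g`, whose derivative `J g` is Hölder continuous of order `1/2`, gives
`ε = h² / 5` (`exists_norm_JJ_sub_le`). With this `ε` the mesh condition makes the constants at most
the ones of the theorem (`constants_le`). Quasi-optimality follows as in Céa's lemma from
`‖A‖ ≤ 1 + μ T² / 2`, because `u_h - w_h` is the Galerkin solution for the data of `u - w_h`.
-/

noncomputable section

namespace IGA

open Set MeasureTheory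

/-! ### Primitives of integrable functions -/

/-- Integration by parts for the primitives of two integrable functions. -/
lemma integral_primitive_mul {f g : ℝ → ℝ} {a b : ℝ}
    (hf : IntervalIntegrable f volume a b) (hg : IntervalIntegrable g volume a b) :
    ∫ t in a..b, (∫ s in a..t, f s) * g t =
      (∫ t in a..b, f t) * (∫ t in a..b, g t) - ∫ t in a..b, f t * ∫ s in a..t, g s := by
  have key := AbsolutelyContinuousOnInterval.integral_mul_deriv_eq_deriv_mul
    (hf.absolutelyContinuousOnInterval_intervalIntegral (c := a) (by simp))
    (hg.absolutelyContinuousOnInterval_intervalIntegral (c := a) (by simp))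
  have e1 : ∫ t in a..b, (∫ s in a..t, f s) * g t
      = ∫ t in a..b, (∫ s in a..t, f s) * deriv (fun x => ∫ s in a..x, g s) t := by
    refine intervalIntegral.integral_congr_ae ?_
    filter_upwards [hg.ae_hasDerivAt_integral] with x hx hm
    rw [(hx (uIoc_subset_uIcc hm) a (by simp)).deriv]
  have e2 : ∫ t in a..b, f t * (∫ s in a..t, g s)
      = ∫ t in a..b, deriv (fun x => ∫ s in a..x, f s) t * ∫ s in a..t, g s := by
    refine intervalIntegral.integral_congr_ae ?_
    filter_upwards [hf.ae_hasDerivAt_integral] with x hx hm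
    rw [(hx (uIoc_subset_uIcc hm) a (by simp)).deriv]
  rw [e1, key, e2]
  simp

/-- The fundamental theorem of calculus for an absolutely continuous function whose derivative is
known almost everywhere. -/
lemma integral_eq_sub_of_ae_hasDerivAt {f f' : ℝ → ℝ} {a b : ℝ}
    (hf : AbsolutelyContinuousOnInterval f a b)
    (h : ∀ᵐ x, x ∈ uIcc a b → HasDerivAt f (f' x) x) :
    ∫ x in a..b, f' x = f b - f a := by
  rw [← hf.integral_deriv_eq_sub]
  refine intervalIntegral.integral_congr_ae ?_
  filter_upwards [h] with x hx hm
  exact (hx (uIoc_subset_uIcc hm)).deriv.symm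

/-- The Cauchy–Schwarz inequality for interval integrals. -/
lemma sq_integral_mul_le {f g : ℝ → ℝ} {a b : ℝ} (hab : a ≤ b)
    (hff : IntervalIntegrable (fun t => f t ^ 2) volume a b)
    (hgg : IntervalIntegrable (fun t => g t ^ 2) volume a b)
    (hfg : IntervalIntegrable (fun t => f t * g t) volume a b) :
    (∫ t in a..b, f t * g t) ^ 2 ≤ (∫ t in a..b, f t ^ 2) * ∫ t in a..b, g t ^ 2 := by
  have h : ∀ x : ℝ, 0 ≤ (∫ t in a..b, g t ^ 2) * (x * x)
      + (2 * ∫ t in a..b, f t * g t) * x + ∫ t in a..b, f t ^ 2 := by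
    intro x
    have e : ∫ t in a..b, (f t + x * g t) ^ 2 = (∫ t in a..b, g t ^ 2) * (x * x)
        + (2 * ∫ t in a..b, f t * g t) * x + ∫ t in a..b, f t ^ 2 := by
      have : (fun t => (f t + x * g t) ^ 2)
          = fun t => ((x * x) * g t ^ 2 + (2 * x) * (f t * g t)) + f t ^ 2 := by
        funext t; ring
      rw [this, intervalIntegral.integral_add ((hgg.const_mul _).add (hfg.const_mul _)) hff,
        intervalIntegral.integral_add (hgg.const_mul _) (hfg.const_mul _),
        intervalIntegral.integral_const_mul, intervalIntegral.integral_const_mul]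
      ring
    rw [← e]
    exact intervalIntegral.integral_nonneg hab fun t _ => sq_nonneg _
  have := discrim_le_zero h
  rw [discrim] at this
  nlinarith

/-! ### The space `L²(0,T)` and the primitive operator -/

section Primitive

variable {T : ℝ} [hT : Fact (0 < T)]

lemma setIntegral_Ioo_eq (f : ℝ → ℝ) : ∫ t in Ioo 0 T, f t = ∫ t in (0 : ℝ)..T, f t := by
  rw [intervalIntegral.integral_of_le hT.out.le, integral_Ioc_eq_integral_Ioo]

lemma intervalIntegrable_of_Ioo {f : ℝ → ℝ} (hf : IntegrableOn f (Ioo 0 T)) :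
    IntervalIntegrable f volume 0 T :=
  (intervalIntegrable_iff_integrableOn_Ioo_of_le hT.out.le).2 hf

lemma L2.intervalIntegrable (g : L2 T) : IntervalIntegrable g volume 0 T :=
  intervalIntegrable_of_Ioo ((Lp.memLp g).integrable (by norm_num))

lemma L2.intervalIntegrable_mul (g k : L2 T) :
    IntervalIntegrable (fun t => g t * k t) volume 0 T :=
  intervalIntegrable_of_Ioo ((Lp.memLp g).integrable_mul (Lp.memLp k))

lemma L2.intervalIntegrable_sq (g : L2 T) :
    IntervalIntegrable (fun t => g t ^ 2) volume 0 T := by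
  simpa only [sq] using L2.intervalIntegrable_mul g g

lemma L2.inner_eq (g k : L2 T) : inner ℝ g k = ∫ t in (0 : ℝ)..T, g t * k t := by
  rw [MeasureTheory.L2.inner_def, ← setIntegral_Ioo_eq]
  refine integral_congr_ae (Filter.Eventually.of_forall fun t => ?_)
  simp [mul_comm]

lemma L2.norm_sq_eq (g : L2 T) : ‖g‖ ^ 2 = ∫ t in (0 : ℝ)..T, g t ^ 2 := by
  rw [← real_inner_self_eq_norm_sq, L2.inner_eq]
  simp only [sq]

/-- Pointwise identities that hold almost everywhere on `(0,T)` can be used on `[0,T]` under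
interval integrals. -/
lemma ae_of_ae_Ioo {p : ℝ → Prop} (h : ∀ᵐ t ∂(volume.restrict (Ioo 0 T)), p t) :
    ∀ᵐ t, t ∈ uIoc 0 T → p t := by
  rw [uIoc_of_le hT.out.le, ← ae_restrict_iff' measurableSet_Ioc,
    ← Measure.restrict_congr_set Ioo_ae_eq_Ioc]
  exact h

lemma uIcc_zero_subset {t : ℝ} (ht : t ∈ Icc 0 T) : uIcc 0 t ⊆ uIcc 0 T := by
  rw [uIcc_of_le ht.1, uIcc_of_le hT.out.le]
  exact Icc_subset_Icc_right ht.2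

lemma uIcc_subset_of_mem {s t : ℝ} (hs : s ∈ Icc 0 T) (ht : t ∈ Icc 0 T) :
    uIcc s t ⊆ uIcc 0 T := by
  rw [uIcc_of_le hT.out.le]
  exact uIcc_subset_Icc hs ht

/-- The element of `L²(0,T)` given by a continuous function on `[0,T]`. -/
def ofCont (u : C(Icc (0 : ℝ) T, ℝ)) : L2 T :=
  MemLp.toLp (ext T u) (by
    obtain ⟨C, hC⟩ := (isCompact_Icc (a := (0 : ℝ)) (b := T)).exists_bound_of_continuousOn
      (continuous_ext u).continuousOn
    refine MemLp.of_bound (continuous_ext u).aestronglyMeasurable C ?_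
    filter_upwards [ae_restrict_mem measurableSet_Ioo] with t ht
    exact hC t (Ioo_subset_Icc_self ht))

lemma ofCont_coe (u : C(Icc (0 : ℝ) T, ℝ)) :
    ofCont u =ᵐ[volume.restrict (Ioo 0 T)] ext T u := MemLp.coeFn_toLp _

lemma ext_apply (u : C(Icc (0 : ℝ) T, ℝ)) {t : ℝ} (ht : t ∈ Icc 0 T) :
    ext T u t = u ⟨t, ht⟩ := IccExtend_of_mem _ _ ht

/-- The primitive of `g ∈ L²(0,T)` that vanishes at `0`. -/
def prim (g : L2 T) : C(Icc (0 : ℝ) T, ℝ) where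
  toFun t := ∫ s in (0 : ℝ)..t, g s
  continuous_toFun := by
    have h := intervalIntegral.continuousOn_primitive_interval (μ := volume) (f := g) (a := 0)
      (b := T) ((intervalIntegrable_iff_integrableOn_Icc_of_le hT.out.le).1
        (L2.intervalIntegrable g) |>.mono_set (by rw [uIcc_of_le hT.out.le]))
    rw [uIcc_of_le hT.out.le] at h
    exact h.domRestrict

lemma prim_apply (g : L2 T) (t : Icc (0 : ℝ) T) : prim g t = ∫ s in (0 : ℝ)..t, g s := rfl

lemma ext_prim (g : L2 T) {t : ℝ} (ht : t ∈ Icc 0 T) :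
    ext T (prim g) t = ∫ s in (0 : ℝ)..t, g s := by
  rw [ext_apply _ ht, prim_apply]

lemma prim_add (g k : L2 T) : prim (g + k) = prim g + prim k := by
  ext t
  rw [ContinuousMap.add_apply, prim_apply, prim_apply, prim_apply,
    ← intervalIntegral.integral_add
      ((L2.intervalIntegrable g).mono_set (uIcc_zero_subset t.2))
      ((L2.intervalIntegrable k).mono_set (uIcc_zero_subset t.2))]
  refine intervalIntegral.integral_congr_ae ?_
  filter_upwards [ae_of_ae_Ioo (Lp.coeFn_add g k)] with x hx hm
  exact hx (uIoc_subset_uIoc_of_uIcc_subset_uIcc (uIcc_zero_subset t.2) hm)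

lemma prim_smul (c : ℝ) (g : L2 T) : prim (c • g) = c • prim g := by
  ext t
  rw [ContinuousMap.smul_apply, prim_apply, prim_apply, smul_eq_mul,
    ← intervalIntegral.integral_const_mul]
  refine intervalIntegral.integral_congr_ae ?_
  filter_upwards [ae_of_ae_Ioo (Lp.coeFn_smul c g)] with x hx hm
  exact hx (uIoc_subset_uIoc_of_uIcc_subset_uIcc (uIcc_zero_subset t.2) hm)

lemma ofCont_add (u v : C(Icc (0 : ℝ) T, ℝ)) : ofCont (u + v) = ofCont u + ofCont v := by
  rw [ofCont, ofCont, ofCont, ← MemLp.toLp_add]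
  rfl

lemma ofCont_smul (c : ℝ) (u : C(Icc (0 : ℝ) T, ℝ)) : ofCont (c • u) = c • ofCont u := by
  rw [ofCont, ofCont, ← MemLp.toLp_const_smul]
  rfl

lemma norm_ofCont_sq (u : C(Icc (0 : ℝ) T, ℝ)) :
    ‖ofCont u‖ ^ 2 = ∫ t in (0 : ℝ)..T, ext T u t ^ 2 := by
  rw [L2.norm_sq_eq]
  refine intervalIntegral.integral_congr_ae ?_
  filter_upwards [ae_of_ae_Ioo (ofCont_coe u)] with x hx hm
  rw [hx hm]

lemma integral_ofCont (u : C(Icc (0 : ℝ) T, ℝ)) {t : ℝ} (ht : t ∈ Icc 0 T) :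
    ∫ s in (0 : ℝ)..t, ofCont u s = ∫ s in (0 : ℝ)..t, ext T u s := by
  refine intervalIntegral.integral_congr_ae ?_
  filter_upwards [ae_of_ae_Ioo (ofCont_coe u)] with x hx hm
  exact hx (uIoc_subset_uIoc_of_uIcc_subset_uIcc (uIcc_zero_subset ht) hm)

/-- The primitive of an `L²` function is Hölder continuous of order `1/2`. -/
lemma sq_prim_sub_le (g : L2 T) {s t : ℝ} (hs : s ∈ Icc 0 T) (ht : t ∈ Icc 0 T) (hst : s ≤ t) :
    (ext T (prim g) t - ext T (prim g) s) ^ 2 ≤ (t - s) * ∫ r in s..t, g r ^ 2 := by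
  have hsub := uIcc_subset_of_mem hs ht
  have h1 := (L2.intervalIntegrable g).mono_set hsub
  rw [ext_prim g hs, ext_prim g ht, intervalIntegral.integral_interval_sub_left
    ((L2.intervalIntegrable g).mono_set (uIcc_zero_subset ht))
    ((L2.intervalIntegrable g).mono_set (uIcc_zero_subset hs))]
  have := sq_integral_mul_le (f := fun _ => 1) (g := g) hst (by simp)
    ((L2.intervalIntegrable_sq g).mono_set hsub) (by simpa using h1)
  simpa using this

lemma integral_sq_le_norm_sq (g : L2 T) {s t : ℝ} (hs : s ∈ Icc 0 T) (ht : t ∈ Icc 0 T)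
    (hst : s ≤ t) : ∫ r in s..t, g r ^ 2 ≤ ‖g‖ ^ 2 := by
  rw [L2.norm_sq_eq]
  exact intervalIntegral.integral_mono_interval hs.1 hst ht.2
    (Filter.Eventually.of_forall fun _ => sq_nonneg _) (L2.intervalIntegrable_sq g)

lemma ext_prim_zero (g : L2 T) : ext T (prim g) 0 = 0 := by
  rw [ext_prim g ⟨le_rfl, hT.out.le⟩, intervalIntegral.integral_same]

lemma norm_ofCont_prim_sq_le (g : L2 T) : ‖ofCont (prim g)‖ ^ 2 ≤ T ^ 2 / 2 * ‖g‖ ^ 2 := by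
  rw [norm_ofCont_sq]
  have h : ∫ t in (0 : ℝ)..T, ext T (prim g) t ^ 2 ≤ ∫ t in (0 : ℝ)..T, t * ‖g‖ ^ 2 := by
    refine intervalIntegral.integral_mono_on hT.out.le
      (((continuous_ext _).pow 2).intervalIntegrable _ _)
      ((continuous_id.mul continuous_const).intervalIntegrable _ _) fun t ht => ?_
    have h0 : (0 : ℝ) ∈ Icc 0 T := ⟨le_rfl, hT.out.le⟩
    have := sq_prim_sub_le g h0 ht ht.1
    rw [ext_prim_zero, sub_zero, sub_zero] at this
    exact this.trans (mul_le_mul_of_nonneg_left (integral_sq_le_norm_sq g h0 ht ht.1) ht.1)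
  rw [intervalIntegral.integral_mul_const, integral_id] at h
  linarith

variable (T) in
/-- The operator `(J g)(t) = ∫₀ᵗ g` on `L²(0,T)`. -/
def J : L2 T →L[ℝ] L2 T :=
  LinearMap.mkContinuous
    { toFun := fun g => ofCont (prim g)
      map_add' := fun g k => by rw [prim_add, ofCont_add]
      map_smul' := fun c g => by rw [prim_smul, ofCont_smul]; rfl }
    (T / √2) (fun g => by
      have hpos := hT.out
      refine le_of_sq_le_sq ?_ (by positivity)
      rw [mul_pow, div_pow, Real.sq_sqrt (by norm_num)]
      exact norm_ofCont_prim_sq_le g)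

lemma J_apply (g : L2 T) : J T g = ofCont (prim g) := rfl

lemma norm_J_le : ‖J T‖ ≤ T / √2 :=
  LinearMap.mkContinuous_norm_le _ (by have := hT.out; positivity) _

lemma prim_J (g : L2 T) (t : Icc (0 : ℝ) T) :
    prim (J T g) t = ∫ s in (0 : ℝ)..t, ext T (prim g) s := by
  rw [prim_apply, J_apply, integral_ofCont _ t.2]

/-! ### The derivative identifies `H¹_{0,*}(0,T)` with `L²(0,T)` -/

/-- The primitive of `g ∈ L²(0,T)` has weak derivative `g`. -/
lemma isWeakDeriv_prim (g : L2 T) : IsWeakDeriv T (ext T (prim g)) g := by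
  intro φ hφ
  have h0 : φ 0 = 0 := image_eq_zero_of_notMem_tsupport fun h => lt_irrefl _ (hφ.supp h).1
  have h1 : φ T = 0 := image_eq_zero_of_notMem_tsupport fun h => lt_irrefl _ (hφ.supp h).2
  have hp : ∀ t, ∫ s in (0 : ℝ)..t, deriv φ s = φ t := fun t => by
    rw [intervalIntegral.integral_deriv_eq_sub
      (fun x _ => (hφ.smooth.differentiable (by simp)).differentiableAt)
      (hφ.continuous_deriv.intervalIntegrable _ _), h0, sub_zero]
  have key := integral_primitive_mul (L2.intervalIntegrable g)
    (hφ.continuous_deriv.intervalIntegrable 0 T)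
  simp only [hp, h1, mul_zero, zero_sub] at key
  rw [setIntegral_Ioo_eq, setIntegral_Ioo_eq, ← key]
  refine intervalIntegral.integral_congr fun t ht => ?_
  rw [uIcc_of_le hT.out.le] at ht
  exact congrArg (· * deriv φ t) (ext_prim g ht)

/-- The primitive of `g ∈ L²(0,T)` that vanishes at `0`, as an element of `H¹_{0,*}(0,T)`. -/
def primLeft (g : L2 T) : H1Left T :=
  ⟨⟨prim g, g, isWeakDeriv_prim g⟩, by
    show ∫ s in (0 : ℝ)..0, g s = 0
    exact intervalIntegral.integral_same⟩

lemma deriv_primLeft (g : L2 T) : H1Left.deriv T (primLeft g) = g :=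
  weakDeriv_eq_of_isWeakDeriv (H1Left.incl T (primLeft g)) (isWeakDeriv_prim g)

lemma primLeft_deriv (u : H1Left T) : primLeft (H1Left.deriv T u) = u :=
  H1Left.deriv_injective T (deriv_primLeft _)

lemma incl_eq_prim (u : H1Left T) : (H1Left.incl T u).1 = prim (H1Left.deriv T u) :=
  congrArg (fun w => (H1Left.incl T w).1) (primLeft_deriv u).symm

variable (T) in
/-- The derivative as an isometric isomorphism of `H¹_{0,*}(0,T)` onto `L²(0,T)`. -/
def derivEquiv : H1Left T ≃ₗᵢ[ℝ] L2 T :=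
  LinearIsometryEquiv.ofSurjective ⟨H1Left.deriv T, fun _ => rfl⟩
    fun g => ⟨primLeft g, deriv_primLeft g⟩

lemma deriv_HT (v : H1Left T) : H1Right.deriv T (HT T v) = -H1Left.deriv T v := by
  show weakDeriv T (⟨ContinuousMap.const _ ((H1Left.incl T v).1 (right T)), 0,
    isWeakDeriv_const _⟩ - H1Left.incl T v) = -weakDeriv T (H1Left.incl T v)
  rw [map_sub, weakDeriv_eq_of_isWeakDeriv ⟨ContinuousMap.const _ _, 0, isWeakDeriv_const _⟩
    (isWeakDeriv_const _), zero_sub]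

lemma norm_HT (v : H1Left T) : ‖HT T v‖ = ‖v‖ := by
  rw [H1Right.norm_def, deriv_HT, norm_neg, H1Left.norm_def]

variable (T) in
/-- The operator `1 + μ J²` on `L²(0,T)`. It represents the form `(u,v) ↦ a(u, H_T v)` in terms of
the derivatives of `u` and `v`. -/
def opA (μ : ℝ) : L2 T →L[ℝ] L2 T := 1 + μ • (J T * J T)

lemma opA_apply (μ : ℝ) (g : L2 T) : opA T μ g = g + μ • J T (J T g) := rfl

/-- In terms of derivatives the form `a(u, H_T v)` is `⟨(1 + μ J²) ∂ₜu, ∂ₜv⟩`: integration by parts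
moves the primitive from `v` to `u`. -/
lemma a_HT (μ : ℝ) (u v : H1Left T) :
    a T μ u (HT T v) = inner ℝ (opA T μ (H1Left.deriv T u)) (H1Left.deriv T v) := by
  rw [a_apply, deriv_HT, inner_neg_right, neg_neg, opA_apply, inner_add_left, inner_smul_left]
  congr 2
  rw [setIntegral_Ioo_eq, L2.inner_eq]
  set g := H1Left.deriv T u
  set k := H1Left.deriv T v
  have hu := (continuous_ext (T := T) (prim g)).intervalIntegrable (μ := volume) 0 T
  have key := integral_primitive_mul hu (L2.intervalIntegrable k)
  have e1 : ∫ t in (0 : ℝ)..T, J T (J T g) t * k t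
      = ∫ t in (0 : ℝ)..T, (∫ s in (0 : ℝ)..t, ext T (prim g) s) * k t := by
    refine intervalIntegral.integral_congr_ae ?_
    filter_upwards [ae_of_ae_Ioo (ofCont_coe (prim (J T g)))] with x hx hm
    have hm' : x ∈ Icc 0 T := by
      rw [uIoc_of_le hT.out.le] at hm
      exact Ioc_subset_Icc_self hm
    rw [J_apply (J T g), hx hm, ext_apply _ hm', prim_J]
  have e2 : ∫ t in (0 : ℝ)..T, ext T (H1Left.incl T u).1 t * ext T (H1Right.incl T (HT T v)).1 t
      = ∫ t in (0 : ℝ)..T, (ext T (prim g) t * (∫ s in (0 : ℝ)..T, k s)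
        - ext T (prim g) t * ∫ s in (0 : ℝ)..t, k s) := by
    refine intervalIntegral.integral_congr fun t ht => ?_
    rw [uIcc_of_le hT.out.le] at ht
    show ext T (H1Left.incl T u).1 t * ext T (H1Right.incl T (HT T v)).1 t = _
    rw [ext_apply (H1Right.incl T (HT T v)).1 ht, HT_apply, incl_eq_prim u, incl_eq_prim v,
      prim_apply, prim_apply, mul_sub]
    rfl
  have i1 : IntervalIntegrable (fun t => ext T (prim g) t * ∫ s in (0 : ℝ)..T, k s) volume 0 T :=
    hu.mul_const _
  have i2 : IntervalIntegrable (fun t => ext T (prim g) t * ∫ s in (0 : ℝ)..t, k s) volume 0 T := by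
    refine hu.mul_continuousOn ?_
    exact ((L2.intervalIntegrable k).absolutelyContinuousOnInterval_intervalIntegral
      (c := 0) (by simp)).continuousOn
  rw [e1, e2, key, intervalIntegral.integral_sub i1 i2, intervalIntegral.integral_mul_const]

/-! ### The initial value problem `U'' + μ U = F` -/

lemma absolutelyContinuousOnInterval_of_hasDerivAt {f f' : ℝ → ℝ} {a b : ℝ} (hf' : Continuous f')
    (h : ∀ x, HasDerivAt f (f' x) x) : AbsolutelyContinuousOnInterval f a b := by
  have e : f = fun x => f a + ∫ t in a..x, f' t := by
    funext x
    rw [intervalIntegral.integral_eq_sub_of_hasDerivAt (fun y _ => h y)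
      (hf'.intervalIntegrable _ _)]
    ring
  have hc : AbsolutelyContinuousOnInterval (fun _ : ℝ => f a) a b :=
    (LipschitzWith.const (f a)).lipschitzOnWith.absolutelyContinuousOnInterval
  rw [e]
  exact hc.add ((hf'.intervalIntegrable a b).absolutelyContinuousOnInterval_intervalIntegral
    (c := a) (by simp))

lemma prim_absolutelyContinuous (g : L2 T) :
    AbsolutelyContinuousOnInterval (fun t => ∫ s in (0 : ℝ)..t, g s) 0 T :=
  (L2.intervalIntegrable g).absolutelyContinuousOnInterval_intervalIntegral (by simp)

/-- Duhamel's formula for `U = J² g`, which satisfies `U'' + ω² U = (1 + ω² J²) g` and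
`U(0) = U'(0) = 0`. -/
lemma duhamel (ω : ℝ) (g : L2 T) {t : ℝ} (ht : t ∈ Icc 0 T) :
    ω * prim (J T g) ⟨t, ht⟩ = ∫ s in (0 : ℝ)..t, Real.sin (ω * (t - s)) * opA T (ω ^ 2) g s := by
  have hw := continuous_ext (T := T) (prim g)
  set U : ℝ → ℝ := fun s => ∫ r in (0 : ℝ)..s, ext T (prim g) r with hU
  have hUd : ∀ s, HasDerivAt U (ext T (prim g) s) s := fun s =>
    intervalIntegral.integral_hasDerivAt_right (hw.intervalIntegrable _ _)
      (hw.stronglyMeasurableAtFilter _ _) hw.continuousAt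
  have hcos : ∀ s, HasDerivAt (fun s => Real.cos (ω * (t - s))) (ω * Real.sin (ω * (t - s))) s := by
    intro s
    have := (((hasDerivAt_const s t).sub (hasDerivAt_id s)).const_mul ω).cos
    convert! this using 1
    simp; ring
  have hsin : ∀ s, HasDerivAt (fun s => Real.sin (ω * (t - s)))
      (-(ω * Real.cos (ω * (t - s)))) s := by
    intro s
    have := (((hasDerivAt_const s t).sub (hasDerivAt_id s)).const_mul ω).sin
    convert! this using 1
    simp; ring
  have hac : AbsolutelyContinuousOnInterval (fun s => ω * (Real.cos (ω * (t - s)) * U s)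
      + Real.sin (ω * (t - s)) * ∫ r in (0 : ℝ)..s, g r) 0 t := by
    refine AbsolutelyContinuousOnInterval.add ?_ ?_
    · refine AbsolutelyContinuousOnInterval.const_mul ω ?_
      exact (absolutelyContinuousOnInterval_of_hasDerivAt (by fun_prop) hcos).fun_mul
        (absolutelyContinuousOnInterval_of_hasDerivAt hw hUd)
    · exact (absolutelyContinuousOnInterval_of_hasDerivAt (by fun_prop) hsin).fun_mul
        ((prim_absolutelyContinuous g).mono (uIcc_zero_subset ht))
  have hF : ∀ᵐ s, s ∈ uIoc 0 T → opA T (ω ^ 2) g s = g s + ω ^ 2 * U s := by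
    filter_upwards [ae_of_ae_Ioo (Lp.coeFn_add g (ω ^ 2 • J T (J T g))),
      ae_of_ae_Ioo (Lp.coeFn_smul (ω ^ 2) (J T (J T g))),
      ae_of_ae_Ioo (ofCont_coe (prim (J T g)))] with s h1 h2 h3 hm
    have hm' : s ∈ Icc 0 T := by
      rw [uIoc_of_le hT.out.le] at hm
      exact Ioc_subset_Icc_self hm
    rw [opA_apply, h1 hm, Pi.add_apply, h2 hm, Pi.smul_apply, J_apply (J T g), h3 hm,
      ext_apply _ hm', prim_J, smul_eq_mul]
  have hd : ∀ᵐ s, s ∈ uIcc 0 t → HasDerivAt (fun s => ω * (Real.cos (ω * (t - s)) * U s)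
      + Real.sin (ω * (t - s)) * ∫ r in (0 : ℝ)..s, g r)
      (Real.sin (ω * (t - s)) * (g s + ω ^ 2 * U s)) s := by
    filter_upwards [(L2.intervalIntegrable g).ae_hasDerivAt_integral] with s hs hm
    have h1 := hs (uIcc_zero_subset ht hm) 0 (by simp)
    have hm' : s ∈ Icc 0 T := by
      have := uIcc_zero_subset ht hm
      rwa [uIcc_of_le hT.out.le] at this
    convert! (((hcos s).mul (hUd s)).const_mul ω).add ((hsin s).mul h1) using 1
    rw [ext_prim g hm']
    ring
  have key := integral_eq_sub_of_ae_hasDerivAt hac hd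
  rw [prim_J]
  have e : ∫ s in (0 : ℝ)..t, Real.sin (ω * (t - s)) * opA T (ω ^ 2) g s
      = ∫ s in (0 : ℝ)..t, Real.sin (ω * (t - s)) * (g s + ω ^ 2 * U s) := by
    refine intervalIntegral.integral_congr_ae ?_
    filter_upwards [hF] with s hs hm
    rw [hs (uIoc_subset_uIoc_of_uIcc_subset_uIcc (uIcc_zero_subset ht) hm)]
  rw [e, key]
  simp [hU]

lemma integral_sin_sq_sub {ω : ℝ} (hω : ω ≠ 0) (t : ℝ) :
    ∫ s in (0 : ℝ)..t, Real.sin (ω * (t - s)) ^ 2 = t / 2 - Real.sin (2 * ω * t) / (4 * ω) := by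
  have h : ∀ s, HasDerivAt (fun s => s / 2 + Real.sin (2 * ω * (t - s)) / (4 * ω))
      (Real.sin (ω * (t - s)) ^ 2) s := by
    intro s
    have h1 := (((hasDerivAt_const s t).sub (hasDerivAt_id s)).const_mul (2 * ω)).sin.div_const
      (4 * ω)
    have h2 := ((hasDerivAt_id s).div_const 2).add h1
    convert! h2 using 1
    have : Real.cos (2 * ω * (t - s)) = 1 - 2 * Real.sin (ω * (t - s)) ^ 2 := by
      rw [show 2 * ω * (t - s) = 2 * (ω * (t - s)) by ring, Real.cos_two_mul, Real.cos_sq']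
      ring
    simp only [Pi.sub_apply, id, this]
    field_simp
    ring
  rw [intervalIntegral.integral_eq_sub_of_hasDerivAt (fun s _ => h s)
    (by apply Continuous.intervalIntegrable; fun_prop)]
  simp

lemma integral_integral_sin_sq_le {ω : ℝ} (hω : ω ≠ 0) (T : ℝ) :
    ∫ t in (0 : ℝ)..T, (t / 2 - Real.sin (2 * ω * t) / (4 * ω)) ≤ T ^ 2 / 4 := by
  have h : ∀ t, HasDerivAt (fun t => t ^ 2 / 4 + Real.cos (2 * ω * t) / (8 * ω ^ 2))
      (t / 2 - Real.sin (2 * ω * t) / (4 * ω)) t := by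
    intro t
    have h1 := ((hasDerivAt_id t).const_mul (2 * ω)).cos.div_const (8 * ω ^ 2)
    have h2 := ((hasDerivAt_pow 2 t).div_const 4).add h1
    convert! h2 using 1
    simp only [id]
    field_simp
    ring
  rw [intervalIntegral.integral_eq_sub_of_hasDerivAt (fun s _ => h s)
    (by apply Continuous.intervalIntegrable; fun_prop)]
  have : Real.cos (2 * ω * T) / (8 * ω ^ 2) ≤ 1 / (8 * ω ^ 2) := by
    gcongr
    exact Real.cos_le_one _
  simp only [mul_zero, Real.cos_zero]
  linarith

/-- The stability estimate for `U'' + ω² U = F`, by Duhamel's formula. -/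
lemma norm_le_opA {ω : ℝ} (hω : 0 < ω) (g : L2 T) :
    ‖g‖ ≤ (1 + ω * T / 2) * ‖opA T (ω ^ 2) g‖ := by
  set F := opA T (ω ^ 2) g with hF
  have hpos := hT.out
  have h1 : ‖ω • J T (J T g)‖ ≤ T / 2 * ‖F‖ := by
    refine le_of_sq_le_sq ?_ (by positivity)
    rw [norm_smul, Real.norm_of_nonneg hω.le, mul_pow, J_apply (J T g), norm_ofCont_sq,
      ← intervalIntegral.integral_const_mul]
    have hle : ∫ t in (0 : ℝ)..T, ω ^ 2 * ext T (prim (J T g)) t ^ 2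
        ≤ ∫ t in (0 : ℝ)..T, (t / 2 - Real.sin (2 * ω * t) / (4 * ω)) * ‖F‖ ^ 2 := by
      refine intervalIntegral.integral_mono_on hpos.le
        ((((continuous_ext _).pow 2).const_mul _).intervalIntegrable _ _)
        (by apply Continuous.intervalIntegrable; fun_prop) fun t ht => ?_
      have hsub := uIcc_zero_subset ht
      have hsc : Continuous fun s => Real.sin (ω * (t - s)) := by fun_prop
      rw [ext_apply _ ht, ← mul_pow, duhamel ω g ht, ← integral_sin_sq_sub hω.ne']
      refine (sq_integral_mul_le ht.1 ((hsc.pow 2).intervalIntegrable _ _)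
        ((L2.intervalIntegrable_sq F).mono_set hsub)
        (((L2.intervalIntegrable F).mono_set hsub).continuousOn_mul hsc.continuousOn)).trans ?_
      refine mul_le_mul_of_nonneg_left (integral_sq_le_norm_sq F ⟨le_rfl, hpos.le⟩ ht ht.1) ?_
      exact intervalIntegral.integral_nonneg ht.1 fun _ _ => sq_nonneg _
    rw [intervalIntegral.integral_mul_const] at hle
    have := mul_le_mul_of_nonneg_right (integral_integral_sin_sq_le hω.ne' T) (sq_nonneg ‖F‖)
    calc _ ≤ _ := hle
      _ ≤ _ := this
      _ = _ := by ring
  have h2 : g = F - ω • (ω • J T (J T g)) := by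
    rw [hF, opA_apply, smul_smul, sq, add_sub_cancel_right]
  calc ‖g‖ = ‖F - ω • (ω • J T (J T g))‖ := by rw [← h2]
    _ ≤ ‖F‖ + ‖ω • (ω • J T (J T g))‖ := norm_sub_le _ _
    _ = ‖F‖ + ω * ‖ω • J T (J T g)‖ := by rw [norm_smul ω (ω • _), Real.norm_of_nonneg hω.le]
    _ ≤ ‖F‖ + ω * (T / 2 * ‖F‖) := by gcongr
    _ = _ := by ring

/-- Solvability of `U'' + ω² U = F`, `U(0) = U'(0) = 0`, by variation of constants. -/
lemma opA_surjective {ω : ℝ} (hω : 0 < ω) : Function.Surjective (opA T (ω ^ 2)) := by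
  intro F
  have hFi := L2.intervalIntegrable F
  have hcosd : ∀ s, HasDerivAt (fun s => Real.cos (ω * s)) (-(ω * Real.sin (ω * s))) s := by
    intro s
    convert! ((hasDerivAt_id s).const_mul ω).cos using 1
    simp; ring
  have hsind : ∀ s, HasDerivAt (fun s => Real.sin (ω * s)) (ω * Real.cos (ω * s)) s := by
    intro s
    convert! ((hasDerivAt_id s).const_mul ω).sin using 1
    simp; ring
  have hci : IntervalIntegrable (fun s => Real.cos (ω * s) * F s) volume 0 T :=
    hFi.continuousOn_mul (by fun_prop)
  have hsi : IntervalIntegrable (fun s => Real.sin (ω * s) * F s) volume 0 T :=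
    hFi.continuousOn_mul (by fun_prop)
  set C : ℝ → ℝ := fun t => ∫ s in (0 : ℝ)..t, Real.cos (ω * s) * F s with hC
  set S : ℝ → ℝ := fun t => ∫ s in (0 : ℝ)..t, Real.sin (ω * s) * F s with hS
  have hCac : AbsolutelyContinuousOnInterval C 0 T :=
    hci.absolutelyContinuousOnInterval_intervalIntegral (by simp)
  have hSac : AbsolutelyContinuousOnInterval S 0 T :=
    hsi.absolutelyContinuousOnInterval_intervalIntegral (by simp)
  have hcac : AbsolutelyContinuousOnInterval (fun s => Real.cos (ω * s)) 0 T :=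
    absolutelyContinuousOnInterval_of_hasDerivAt (by fun_prop) hcosd
  have hsac : AbsolutelyContinuousOnInterval (fun s => Real.sin (ω * s)) 0 T :=
    absolutelyContinuousOnInterval_of_hasDerivAt (by fun_prop) hsind
  -- `w` is the derivative of the solution and `V` is `ω` times the solution.
  set w : ℝ → ℝ := fun t => Real.cos (ω * t) * C t + Real.sin (ω * t) * S t with hw
  set V : ℝ → ℝ := fun t => Real.sin (ω * t) * C t - Real.cos (ω * t) * S t with hV
  have hwac : AbsolutelyContinuousOnInterval w 0 T := (hcac.fun_mul hCac).add (hsac.fun_mul hSac)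
  have hVac : AbsolutelyContinuousOnInterval V 0 T := (hsac.fun_mul hCac).sub (hcac.fun_mul hSac)
  have hwd : ∀ᵐ t, t ∈ uIcc 0 T → HasDerivAt w (F t - ω * V t) t := by
    filter_upwards [hci.ae_hasDerivAt_integral, hsi.ae_hasDerivAt_integral] with t h1 h2 hm
    convert! ((hcosd t).mul (h1 hm 0 (by simp))).add ((hsind t).mul (h2 hm 0 (by simp))) using 1
    have := Real.sin_sq_add_cos_sq (ω * t)
    simp only [hV, hC, hS]
    linear_combination (-F t) * this
  have hVd : ∀ᵐ t, t ∈ uIcc 0 T → HasDerivAt V (ω * w t) t := by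
    filter_upwards [hci.ae_hasDerivAt_integral, hsi.ae_hasDerivAt_integral] with t h1 h2 hm
    convert! ((hsind t).mul (h1 hm 0 (by simp))).sub ((hcosd t).mul (h2 hm 0 (by simp))) using 1
    simp only [hw, hC, hS]
    ring
  have hw0 : w 0 = 0 := by simp [hw, hC, hS]
  have hV0 : V 0 = 0 := by simp [hV, hC, hS]
  have hVc : ContinuousOn V (Icc 0 T) := by
    have := hVac.continuousOn
    rwa [uIcc_of_le hT.out.le] at this
  let Vc : C(Icc (0 : ℝ) T, ℝ) := ⟨fun t => V t, hVc.domRestrict⟩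
  have hVext : ∀ t ∈ Icc 0 T, ext T Vc t = V t := fun t ht => ext_apply Vc ht
  refine ⟨F - ω • ofCont Vc, ?_⟩
  set g := F - ω • ofCont Vc with hg
  have hgae : ∀ᵐ s, s ∈ uIoc 0 T → g s = F s - ω * V s := by
    filter_upwards [ae_of_ae_Ioo (Lp.coeFn_sub F (ω • ofCont Vc)),
      ae_of_ae_Ioo (Lp.coeFn_smul ω (ofCont Vc)), ae_of_ae_Ioo (ofCont_coe Vc)] with s h1 h2 h3 hm
    have hm' : s ∈ Icc 0 T := by
      rw [uIoc_of_le hT.out.le] at hm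
      exact Ioc_subset_Icc_self hm
    rw [hg, h1 hm, Pi.sub_apply, h2 hm, Pi.smul_apply, h3 hm, hVext s hm', smul_eq_mul]
  have hpg : ∀ t ∈ Icc 0 T, ext T (prim g) t = w t := by
    intro t ht
    have hsub := uIcc_zero_subset ht
    have key := integral_eq_sub_of_ae_hasDerivAt (hwac.mono hsub)
      (by filter_upwards [hwd] with x hx hm using hx (hsub hm))
    rw [hw0, sub_zero] at key
    rw [ext_prim g ht, ← key]
    refine intervalIntegral.integral_congr_ae ?_
    filter_upwards [hgae] with s hs hm
    exact hs (uIoc_subset_uIoc_of_uIcc_subset_uIcc hsub hm)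
  have hJg : prim (J T g) = ω⁻¹ • Vc := by
    ext t
    have hsub := uIcc_zero_subset t.2
    rw [prim_J, ContinuousMap.smul_apply, smul_eq_mul, eq_inv_mul_iff_mul_eq₀ hω.ne',
      ← intervalIntegral.integral_const_mul]
    have key := integral_eq_sub_of_ae_hasDerivAt (hVac.mono hsub)
      (by filter_upwards [hVd] with x hx hm using hx (hsub hm))
    rw [hV0, sub_zero] at key
    refine Eq.trans ?_ key
    refine intervalIntegral.integral_congr fun s hs => ?_
    have hs' := hsub hs
    rw [uIcc_of_le hT.out.le] at hs'
    exact congrArg (ω * ·) (hpg s hs')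
  rw [opA_apply, J_apply (J T g), hJg, ofCont_smul, smul_smul, hg, sq,
    mul_inv_cancel_right₀ hω.ne', sub_add_cancel]

/-- The operator `1 + ω² J²` is invertible, with inverse of norm at most `1 + ω T / 2`. -/
lemma exists_inverse_opA {ω : ℝ} (hω : 0 < ω) :
    ∃ B : L2 T →L[ℝ] L2 T, (∀ g, B (opA T (ω ^ 2) g) = g) ∧ (∀ F, opA T (ω ^ 2) (B F) = F) ∧
      ‖B‖ ≤ 1 + ω * T / 2 := by
  have hpos := hT.out
  have hinj : Function.Injective (opA T (ω ^ 2)) := by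
    refine (injective_iff_map_eq_zero _).2 fun g hg => ?_
    have := norm_le_opA hω g
    rw [hg, norm_zero, mul_zero] at this
    exact norm_le_zero_iff.1 this
  let e := LinearEquiv.ofBijective (opA T (ω ^ 2)).toLinearMap ⟨hinj, opA_surjective hω⟩
  have he : ∀ F, opA T (ω ^ 2) (e.symm F) = F := fun F => e.apply_symm_apply F
  refine ⟨e.symm.toLinearMap.mkContinuous (1 + ω * T / 2) fun F => ?_, fun g => ?_, he, ?_⟩
  · have := norm_le_opA hω (e.symm F)
    rwa [he] at this
  · exact e.symm_apply_apply g
  · exact LinearMap.mkContinuous_norm_le _ (by positivity) _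

lemma norm_opA_apply_le {μ : ℝ} (hμ : 0 ≤ μ) (g : L2 T) :
    ‖opA T μ g‖ ≤ (1 + μ * T ^ 2 / 2) * ‖g‖ := by
  have hpos := hT.out
  have hJ : ∀ k : L2 T, ‖J T k‖ ≤ T / √2 * ‖k‖ := fun k =>
    ((J T).le_opNorm k).trans (mul_le_mul_of_nonneg_right norm_J_le (norm_nonneg _))
  calc ‖opA T μ g‖ ≤ ‖g‖ + μ * ‖J T (J T g)‖ := by
        rw [opA_apply]
        refine (norm_add_le _ _).trans ?_
        rw [norm_smul, Real.norm_of_nonneg hμ]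
    _ ≤ ‖g‖ + μ * (T / √2 * (T / √2 * ‖g‖)) := by
        gcongr
        exact (hJ _).trans (mul_le_mul_of_nonneg_left (hJ g) (by positivity))
    _ = ‖g‖ + μ * (T ^ 2 / (√2) ^ 2 * ‖g‖) := by ring
    _ = _ := by rw [Real.sq_sqrt (by norm_num)]; ring

end Primitive

/-! ### Galerkin methods for a perturbation of the identity -/

/-- A discrete inf-sup condition for `1 + μ K` on a subspace `W` that approximates the range of `K`.
The test function is the orthogonal projection onto `W` of the solution of the adjoint problem with
right-hand side `g`. -/
lemma exists_discrete_infSup {H : Type*} [NormedAddCommGroup H] [InnerProductSpace ℝ H]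
    [CompleteSpace H] (W : Submodule ℝ H) [W.HasOrthogonalProjection] {A B K : H →L[ℝ] H}
    {μ ε L : ℝ} (hμ : 0 ≤ μ) (hA : ∀ g, A g = g + μ • K g) (hBA : ∀ g, B (A g) = g)
    (hB : ‖B‖ ≤ L) (hε : ∀ g, ∃ k ∈ W, ‖K g - k‖ ≤ ε * ‖g‖) (g : H) (hg : g ∈ W) :
    ∃ w ∈ W, ‖w‖ ≤ L * ‖g‖ ∧ (1 - μ * ε * L) * ‖g‖ ^ 2 ≤ inner ℝ (A g) w := by
  set v := ContinuousLinearMap.adjoint B g with hv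
  have hvL : ‖v‖ ≤ L * ‖g‖ :=
    (ContinuousLinearMap.le_opNorm _ _).trans (by
      rw [LinearIsometryEquiv.norm_map]; exact mul_le_mul_of_nonneg_right hB (norm_nonneg _))
  have hAv : inner ℝ (A g) v = ‖g‖ ^ 2 := by
    rw [hv, ContinuousLinearMap.adjoint_inner_right, hBA, real_inner_self_eq_norm_sq]
  refine ⟨W.starProjection v, W.starProjection_apply_mem v,
    (W.norm_starProjection_apply_le v).trans hvL, ?_⟩
  obtain ⟨k, hk, hkε⟩ := hε g
  have horth : ∀ x ∈ W, inner ℝ x (v - W.starProjection v) = 0 := fun x hx =>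
    (W.mem_orthogonal _).1 (W.sub_starProjection_mem_orthogonal v) x hx
  have hle : ‖v - W.starProjection v‖ ≤ ‖v‖ := by
    have := Wᗮ.norm_starProjection_apply_le v
    rwa [Submodule.starProjection_orthogonal'] at this
  have e : inner ℝ (A g) (W.starProjection v)
      = ‖g‖ ^ 2 - μ * inner ℝ (K g - k) (v - W.starProjection v) := by
    have e1 : inner ℝ (A g) (v - W.starProjection v)
        = μ * inner ℝ (K g - k) (v - W.starProjection v) := by
      rw [hA, inner_add_left, horth g hg, inner_smul_left, inner_sub_left, horth k hk]
      simp
    rw [← e1, inner_sub_right, hAv]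
    ring
  rw [e]
  have h3 : inner ℝ (K g - k) (v - W.starProjection v) ≤ (ε * ‖g‖) * (L * ‖g‖) :=
    (real_inner_le_norm _ _).trans (mul_le_mul hkε (hle.trans hvL) (norm_nonneg _)
      ((norm_nonneg _).trans hkε))
  nlinarith [mul_le_mul_of_nonneg_left h3 hμ]

/-! ### Knots and quadratic B-splines -/

section Knots

variable {T : ℝ} {N : ℕ} {ξ : ℕ → ℝ}

lemma IsOpenKnotVector.three_le [hT : Fact (0 < T)] (hξ : IsOpenKnotVector T N ξ) : 3 ≤ N := by
  have hpos := hT.out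
  by_contra hN
  have h1 := hξ.one
  have h2 := hξ.two
  have h3 := hξ.three
  have h := hξ.last₁
  have : N = 0 ∨ N = 1 ∨ N = 2 := by omega
  rcases this with rfl | rfl | rfl
  · exact hpos.ne (h1.symm.trans h)
  · exact hpos.ne (h2.symm.trans h)
  · exact hpos.ne (h3.symm.trans h)

lemma IsOpenKnotVector.lt_succ (hξ : IsOpenKnotVector T N ξ) {k : ℕ} (h3 : 3 ≤ k) (hN : k ≤ N) :
    ξ k < ξ (k + 1) :=
  hξ.strictMono ⟨h3, by omega⟩ ⟨by omega, by omega⟩ (Nat.lt_succ_self k)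

lemma IsOpenKnotVector.le_succ (hξ : IsOpenKnotVector T N ξ) {k : ℕ} (h1 : 1 ≤ k)
    (hN : k ≤ N + 2) : ξ k ≤ ξ (k + 1) := by
  have : k = 1 ∨ k = 2 ∨ (3 ≤ k ∧ k ≤ N) ∨ k = N + 1 ∨ k = N + 2 := by
    omega
  rcases this with rfl | rfl | h | rfl | rfl
  · rw [hξ.one, hξ.two]
  · rw [hξ.two, hξ.three]
  · exact (hξ.lt_succ h.1 h.2).le
  · rw [hξ.last₁, hξ.last₂]
  · rw [hξ.last₂, hξ.last₃]

lemma IsOpenKnotVector.mono (hξ : IsOpenKnotVector T N ξ) {i j : ℕ} (h1 : 1 ≤ i) (hij : i ≤ j)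
    (hN : j ≤ N + 3) : ξ i ≤ ξ j := by
  induction j, hij using Nat.le_induction with
  | base => exact le_rfl
  | succ n hn ih => exact (ih (by omega)).trans (hξ.le_succ (by omega) (by omega))

lemma IsOpenKnotVector.mem_Icc (hξ : IsOpenKnotVector T N ξ) {k : ℕ} (h1 : 1 ≤ k)
    (hN : k ≤ N + 3) : ξ k ∈ Icc 0 T :=
  ⟨hξ.one ▸ hξ.mono le_rfl h1 hN, hξ.last₃ ▸ hξ.mono h1 hN le_rfl⟩

/-- Every point of `[0,T)` lies in one of the elements `[ξ k, ξ (k + 1))`, `3 ≤ k ≤ N`. -/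
lemma IsOpenKnotVector.exists_mem_Ico [Fact (0 < T)] (hξ : IsOpenKnotVector T N ξ) {x : ℝ}
    (hx : x ∈ Ico 0 T) :
    ∃ k, 3 ≤ k ∧ k ≤ N ∧ x ∈ Ico (ξ k) (ξ (k + 1)) := by
  have h : ∀ n, 3 ≤ n → n ≤ N + 1 → x < ξ n → ∃ k, 3 ≤ k ∧ k ≤ N ∧ x ∈ Ico (ξ k) (ξ (k + 1)) := by
    intro n hn
    induction n, hn using Nat.le_induction with
    | base => intro _ h; rw [hξ.three] at h; exact absurd hx.1 (not_le.2 h)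
    | succ n hn ih =>
      intro hN h
      rcases lt_or_ge x (ξ n) with h' | h'
      · exact ih (by omega) h'
      · exact ⟨n, hn, by omega, h', h⟩
  exact h (N + 1) (by have := hξ.three_le; omega) le_rfl (hξ.last₁ ▸ hx.2)

/-- The element that contains a given point is unique. -/
lemma IsOpenKnotVector.eq_of_mem_Ico (hξ : IsOpenKnotVector T N ξ) {x : ℝ} {j k : ℕ}
    (hj : 1 ≤ j) (hjN : j ≤ N + 2) (hk : 1 ≤ k) (hkN : k ≤ N + 2)
    (hxj : x ∈ Ico (ξ j) (ξ (j + 1))) (hxk : x ∈ Ico (ξ k) (ξ (k + 1))) : j = k := by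
  rcases lt_trichotomy j k with h | h | h
  · exact absurd (hxj.2.trans_le (hξ.mono (by omega) h (by omega))) (not_lt.2 hxk.1)
  · exact h
  · exact absurd (hxk.2.trans_le (hξ.mono (by omega) h (by omega))) (not_lt.2 hxj.1)

lemma sub_le_meshSize (ξ : ℕ → ℝ) {k : ℕ} (h1 : 1 ≤ k) (hN : k ≤ N + 2) :
    ξ (k + 1) - ξ k ≤ meshSize N ξ :=
  (le_abs_self _).trans (Finset.le_sup' (fun i => |ξ (i + 1) - ξ i|) (Finset.mem_Icc.2 ⟨h1, hN⟩))

lemma IsOpenKnotVector.meshSize_le (hξ : IsOpenKnotVector T N ξ) : meshSize N ξ ≤ T := by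
  refine Finset.sup'_le _ _ fun i hi => ?_
  rw [Finset.mem_Icc] at hi
  have h1 := hξ.mem_Icc hi.1 (by omega)
  have h2 := hξ.mem_Icc (k := i + 1) (by omega) (by omega)
  rw [abs_le]
  constructor <;> linarith [h1.1, h1.2, h2.1, h2.2]

lemma meshSize_nonneg (N : ℕ) (ξ : ℕ → ℝ) : 0 ≤ meshSize N ξ :=
  (abs_nonneg _).trans
    (Finset.le_sup' (fun i => |ξ (i + 1) - ξ i|) (Finset.mem_Icc.2 ⟨le_rfl, by omega⟩))

end Knots

lemma coxDeBoor_zero_of_mem {ξ : ℕ → ℝ} {j : ℕ} {x : ℝ} (hx : x ∈ Ico (ξ j) (ξ (j + 1))) :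
    coxDeBoor ξ 0 j x = 1 := by
  rw [coxDeBoor, if_pos hx]

lemma coxDeBoor_of_notMem {ξ : ℕ → ℝ} {p j : ℕ} {x : ℝ} (hx : x ∉ Ico (ξ j) (ξ (j + p + 1))) :
    coxDeBoor ξ p j x = 0 := by
  cases p with
  | zero => rw [coxDeBoor, if_neg hx]
  | succ p => exact if_neg hx

lemma coxDeBoor_succ_of_mem {ξ : ℕ → ℝ} {p j : ℕ} {x : ℝ} (hx : x ∈ Ico (ξ j) (ξ (j + p + 2))) :
    coxDeBoor ξ (p + 1) j x = (x - ξ j) / (ξ (j + p + 1) - ξ j) * coxDeBoor ξ p j x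
      + (ξ (j + p + 2) - x) / (ξ (j + p + 2) - ξ (j + 1)) * coxDeBoor ξ p (j + 1) x := by
  rw [coxDeBoor, if_pos hx]

/-- B-splines have limits from the left. -/
lemma exists_tendsto_coxDeBoor (ξ : ℕ → ℝ) (p j : ℕ) (x : ℝ) :
    ∃ l, Filter.Tendsto (coxDeBoor ξ p j) (nhdsWithin x (Iio x)) (nhds l) := by
  classical
  have hind : ∀ (a b : ℝ) (f : ℝ → ℝ) (l : ℝ), Filter.Tendsto f (nhdsWithin x (Iio x)) (nhds l) →
      ∃ l, Filter.Tendsto (fun y => if y ∈ Ico a b then f y else 0) (nhdsWithin x (Iio x))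
        (nhds l) := by
    intro a b f l hf
    by_cases h : a < x ∧ x ≤ b
    · refine ⟨l, hf.congr' ?_⟩
      filter_upwards [Ioo_mem_nhdsLT h.1] with y hy
      rw [if_pos ⟨hy.1.le, hy.2.trans_le h.2⟩]
    · refine ⟨0, tendsto_const_nhds.congr' ?_⟩
      rcases not_and_or.1 h with h' | h'
      · filter_upwards [self_mem_nhdsWithin] with y hy
        rw [if_neg fun hm => h' (hm.1.trans_lt hy)]
      · filter_upwards [Ioo_mem_nhdsLT (not_le.1 h')] with y hy
        rw [if_neg fun hm => lt_asymm hm.2 hy.1]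
  induction p generalizing j with
  | zero =>
    obtain ⟨l, hl⟩ := hind (ξ j) (ξ (j + 1)) (fun _ => 1) 1 tendsto_const_nhds
    refine ⟨l, hl.congr fun y => ?_⟩
    rw [coxDeBoor]
  | succ p ih =>
    obtain ⟨l₁, h₁⟩ := ih j
    obtain ⟨l₂, h₂⟩ := ih (j + 1)
    have hc : ∀ f : ℝ → ℝ, Continuous f → Filter.Tendsto f (nhdsWithin x (Iio x)) (nhds (f x)) :=
      fun f hf => (hf.tendsto x).mono_left nhdsWithin_le_nhds
    obtain ⟨l, hl⟩ := hind (ξ j) (ξ (j + p + 2)) _ _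
      (((hc (fun y => (y - ξ j) / (ξ (j + p + 1) - ξ j)) (by fun_prop)).mul h₁).add
        ((hc (fun y => (ξ (j + p + 2) - y) / (ξ (j + p + 2) - ξ (j + 1))) (by fun_prop)).mul h₂))
    refine ⟨l, hl.congr fun y => ?_⟩
    rw [coxDeBoor]

section Splines

variable {T : ℝ} {N : ℕ} {ξ : ℕ → ℝ}

/-- The values of the three quadratic B-splines that do not vanish on an element. -/
lemma coxDeBoor_two_of_mem (hξ : IsOpenKnotVector T N ξ) {m : ℕ} (hm : 1 ≤ m) (hmN : m + 2 ≤ N)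
    {x : ℝ} (hx : x ∈ Ico (ξ (m + 2)) (ξ (m + 3))) :
    coxDeBoor ξ 2 m x = (ξ (m + 3) - x) / (ξ (m + 3) - ξ (m + 1))
      * ((ξ (m + 3) - x) / (ξ (m + 3) - ξ (m + 2))) ∧
    coxDeBoor ξ 2 (m + 1) x = (x - ξ (m + 1)) / (ξ (m + 3) - ξ (m + 1))
      * ((ξ (m + 3) - x) / (ξ (m + 3) - ξ (m + 2)))
      + (ξ (m + 4) - x) / (ξ (m + 4) - ξ (m + 2))
      * ((x - ξ (m + 2)) / (ξ (m + 3) - ξ (m + 2))) ∧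
    coxDeBoor ξ 2 (m + 2) x = (x - ξ (m + 2)) / (ξ (m + 4) - ξ (m + 2))
      * ((x - ξ (m + 2)) / (ξ (m + 3) - ξ (m + 2))) := by
  have k0 : ξ m ≤ ξ (m + 1) := hξ.mono hm (by omega) (by omega)
  have k1 : ξ (m + 1) ≤ ξ (m + 2) := hξ.mono (by omega) (by omega) (by omega)
  have k3 : ξ (m + 3) ≤ ξ (m + 4) := hξ.mono (by omega) (by omega) (by omega)
  have k4 : ξ (m + 4) ≤ ξ (m + 5) := hξ.mono (by omega) (by omega) (by omega)
  obtain ⟨hx1, hx2⟩ := hx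
  have z1 : coxDeBoor ξ 0 (m + 1) x = 0 := coxDeBoor_of_notMem fun h => not_lt.2 hx1 h.2
  have z2 : coxDeBoor ξ 0 (m + 2) x = 1 := coxDeBoor_zero_of_mem ⟨hx1, hx2⟩
  have z3 : coxDeBoor ξ 0 (m + 3) x = 0 := coxDeBoor_of_notMem fun h => not_lt.2 h.1 hx2
  have o0 : coxDeBoor ξ 1 m x = 0 := coxDeBoor_of_notMem fun h => not_lt.2 hx1 h.2
  have o3 : coxDeBoor ξ 1 (m + 3) x = 0 := coxDeBoor_of_notMem fun h => not_lt.2 h.1 hx2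
  have o1 := coxDeBoor_succ_of_mem (ξ := ξ) (p := 0) (j := m + 1) (x := x)
    ⟨k1.trans hx1, hx2⟩
  have o2 := coxDeBoor_succ_of_mem (ξ := ξ) (p := 0) (j := m + 2) (x := x)
    ⟨hx1, hx2.trans_le k3⟩
  have t0 := coxDeBoor_succ_of_mem (ξ := ξ) (p := 1) (j := m) (x := x)
    ⟨(k0.trans k1).trans hx1, hx2⟩
  have t1 := coxDeBoor_succ_of_mem (ξ := ξ) (p := 1) (j := m + 1) (x := x)
    ⟨k1.trans hx1, hx2.trans_le k3⟩
  have t2 := coxDeBoor_succ_of_mem (ξ := ξ) (p := 1) (j := m + 2) (x := x)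
    ⟨hx1, hx2.trans_le (k3.trans k4)⟩
  simp only [zero_add, add_assoc, Nat.reduceAdd, z1, z2, z3, o0, o3, mul_zero, mul_one, add_zero]
    at o1 o2 t0 t1 t2
  exact ⟨by rw [t0, o1], by rw [t1, o1, o2], by rw [t2, o2]⟩

/-- On an element only three quadratic B-splines contribute to a spline. -/
lemma sum_coxDeBoor_of_mem (hξ : IsOpenKnotVector T N ξ) {m : ℕ} (hm : 1 ≤ m) (hmN : m + 2 ≤ N)
    {x : ℝ} (hx : x ∈ Ico (ξ (m + 2)) (ξ (m + 3))) (c : ℕ → ℝ) :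
    ∑ i ∈ Finset.Icc 1 N, c i * coxDeBoor ξ 2 i x = c m * coxDeBoor ξ 2 m x
      + c (m + 1) * coxDeBoor ξ 2 (m + 1) x + c (m + 2) * coxDeBoor ξ 2 (m + 2) x := by
  have hsub : ({m, m + 1, m + 2} : Finset ℕ) ⊆ Finset.Icc 1 N := by
    intro i hi
    simp only [Finset.mem_insert, Finset.mem_singleton] at hi
    rw [Finset.mem_Icc]
    omega
  rw [← Finset.sum_subset hsub fun i hi hni => ?_]
  · rw [Finset.sum_insert (by simp), Finset.sum_insert (by simp), Finset.sum_singleton, add_assoc]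
  · rw [Finset.mem_Icc] at hi
    simp only [Finset.mem_insert, Finset.mem_singleton, not_or] at hni
    rw [coxDeBoor_of_notMem, mul_zero]
    intro h
    rcases lt_or_ge i m with h' | h'
    · exact not_lt.2 hx.1 (h.2.trans_le (hξ.mono (by omega) (by omega) (by omega)))
    · exact not_lt.2 h.1 (hx.2.trans_le (hξ.mono (by omega) (by omega) (by omega)))

/-- The trapezoidal sums `∑ (y i + y (i + 1)) / 2 * (ξ (i + 1) - ξ i)` over `1 ≤ i < k`. -/
def trapSum (ξ y : ℕ → ℝ) (k : ℕ) : ℝ :=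
  ∑ i ∈ Finset.Ico 1 k, (y i + y (i + 1)) / 2 * (ξ (i + 1) - ξ i)

lemma trapSum_succ (ξ y : ℕ → ℝ) {k : ℕ} (hk : 1 ≤ k) :
    trapSum ξ y (k + 1) = trapSum ξ y k + (y k + y (k + 1)) / 2 * (ξ (k + 1) - ξ k) :=
  Finset.sum_Ico_succ_top hk _

lemma trapSum_three (hξ : IsOpenKnotVector T N ξ) (y : ℕ → ℝ) : trapSum ξ y 3 = 0 := by
  rw [trapSum_succ ξ y (by norm_num), trapSum_succ ξ y le_rfl, hξ.one, hξ.two, hξ.three]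
  simp [trapSum]

/-- The B-spline coefficients of the primitive of the continuous piecewise linear function with
values `y k` at the knots `ξ k`. The `i`-th coefficient is the polar form, at the knots `ξ (i + 1)`
and `ξ (i + 2)`, of the quadratic polynomial that represents the primitive on an element. -/
def splineCoeff (ξ y : ℕ → ℝ) (i : ℕ) : ℝ :=
  trapSum ξ y (i + 1) + y (i + 1) * (ξ (i + 2) - ξ (i + 1)) / 2

lemma sum_splineCoeff_of_mem (hξ : IsOpenKnotVector T N ξ) (y : ℕ → ℝ) {k : ℕ} (hk : 3 ≤ k)
    (hkN : k ≤ N) {x : ℝ} (hx : x ∈ Ico (ξ k) (ξ (k + 1))) :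
    ∑ i ∈ Finset.Icc 1 N, splineCoeff ξ y i * coxDeBoor ξ 2 i x = trapSum ξ y k
      + (y k * (x - ξ k) + (y (k + 1) - y k) / (ξ (k + 1) - ξ k) * ((x - ξ k) ^ 2 / 2)) := by
  obtain ⟨m, rfl⟩ : ∃ m, k = m + 2 := ⟨k - 2, by omega⟩
  have hm : 1 ≤ m := by omega
  obtain ⟨b0, b1, b2⟩ := coxDeBoor_two_of_mem hξ hm hkN hx
  have k1 : ξ (m + 1) ≤ ξ (m + 2) := hξ.mono (by omega) (by omega) (by omega)
  have k2 : ξ (m + 2) < ξ (m + 3) := hξ.lt_succ hk hkN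
  have k3 : ξ (m + 3) ≤ ξ (m + 4) := hξ.mono (by omega) (by omega) (by omega)
  have s1 := trapSum_succ ξ y (k := m + 1) (by omega)
  have s2 := trapSum_succ ξ y (k := m + 2) (by omega)
  rw [sum_coxDeBoor_of_mem hξ hm hkN hx, b0, b1, b2]
  simp only [splineCoeff, add_assoc, Nat.reduceAdd] at s1 s2 ⊢
  have e1 : trapSum ξ y (m + 1)
      = trapSum ξ y (m + 2) - (y (m + 1) + y (m + 2)) / 2 * (ξ (m + 2) - ξ (m + 1)) := by
    rw [s1]; ring
  rw [e1, s2]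
  have d1 : ξ (m + 3) - ξ (m + 1) ≠ 0 := by linarith
  have d2 : ξ (m + 3) - ξ (m + 2) ≠ 0 := by linarith
  have d3 : ξ (m + 4) - ξ (m + 2) ≠ 0 := by linarith
  generalize ξ (m + 1) = p1 at *
  generalize ξ (m + 2) = p2 at *
  generalize ξ (m + 3) = p3 at *
  generalize ξ (m + 4) = p4 at *
  field_simp
  ring

/-! ### Piecewise linear interpolation -/

/-- The affine function with values `y k` at `ξ k` and `y (k + 1)` at `ξ (k + 1)`. -/
def affinePiece (ξ y : ℕ → ℝ) (k : ℕ) (t : ℝ) : ℝ :=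
  y k + (y (k + 1) - y k) / (ξ (k + 1) - ξ k) * (t - ξ k)

lemma continuous_affinePiece (ξ y : ℕ → ℝ) (k : ℕ) : Continuous (affinePiece ξ y k) := by
  unfold affinePiece
  fun_prop

/-- The continuous piecewise linear function on `[0,T)` with values `y k` at the knots `ξ k`; it is
`0` outside `[0,T)`. -/
def piecewiseLinear (N : ℕ) (ξ y : ℕ → ℝ) (t : ℝ) : ℝ :=
  ∑ k ∈ Finset.Icc 3 N, (Ico (ξ k) (ξ (k + 1))).indicator (affinePiece ξ y k) t

lemma piecewiseLinear_of_mem (hξ : IsOpenKnotVector T N ξ) (y : ℕ → ℝ) {k : ℕ} (hk : 3 ≤ k)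
    (hkN : k ≤ N) {t : ℝ} (ht : t ∈ Ico (ξ k) (ξ (k + 1))) :
    piecewiseLinear N ξ y t = affinePiece ξ y k t := by
  rw [piecewiseLinear, Finset.sum_eq_single k, indicator_of_mem ht]
  · intro j hj hjk
    rw [Finset.mem_Icc] at hj
    refine indicator_of_notMem (fun h => hjk ?_) _
    exact hξ.eq_of_mem_Ico (by omega) (by omega) (by omega) (by omega) h ht
  · intro h
    exact absurd (Finset.mem_Icc.2 ⟨hk, hkN⟩) h

variable (T) in
lemma memLp_piecewiseLinear (N : ℕ) (ξ y : ℕ → ℝ) :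
    MemLp (piecewiseLinear N ξ y) 2 (volume.restrict (Ioo (0 : ℝ) T)) := by
  refine memLp_finsetSum _ fun k _ => MemLp.indicator measurableSet_Ico ?_
  have hc := continuous_affinePiece ξ y k
  obtain ⟨C, hC⟩ := (isCompact_Icc (a := (0 : ℝ)) (b := T)).exists_bound_of_continuousOn
    hc.continuousOn
  refine MemLp.of_bound hc.aestronglyMeasurable C ?_
  filter_upwards [ae_restrict_mem measurableSet_Ioo] with t ht
  exact hC t (Ioo_subset_Icc_self ht)

variable (T) in
/-- The piecewise linear function with values `y k` at the knots `ξ k`, in `L²(0,T)`. -/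
def plL2 (N : ℕ) (ξ y : ℕ → ℝ) : L2 T := (memLp_piecewiseLinear T N ξ y).toLp

lemma integral_affinePiece (ξ y : ℕ → ℝ) (k : ℕ) (x : ℝ) :
    ∫ t in ξ k..x, affinePiece ξ y k t
      = y k * (x - ξ k) + (y (k + 1) - y k) / (ξ (k + 1) - ξ k) * ((x - ξ k) ^ 2 / 2) := by
  have h : ∀ t, HasDerivAt (fun t => y k * (t - ξ k)
      + (y (k + 1) - y k) / (ξ (k + 1) - ξ k) * ((t - ξ k) ^ 2 / 2)) (affinePiece ξ y k t) t := by
    intro t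
    have h1 := (hasDerivAt_id t).sub_const (ξ k)
    convert! (h1.const_mul (y k)).add (((h1.pow 2).div_const 2).const_mul
      ((y (k + 1) - y k) / (ξ (k + 1) - ξ k))) using 1
    simp only [affinePiece, id]
    ring
  rw [intervalIntegral.integral_eq_sub_of_hasDerivAt (fun t _ => h t)
    ((continuous_affinePiece ξ y k).intervalIntegrable _ _)]
  simp

lemma intervalIntegrable_piecewiseLinear (T : ℝ) [ Fact (0 < T)] (N : ℕ) (ξ y : ℕ → ℝ) :
    IntervalIntegrable (piecewiseLinear N ξ y) volume 0 T :=
  intervalIntegrable_of_Ioo ((memLp_piecewiseLinear T N ξ y).integrable (by norm_num))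

/-- On an element the function `piecewiseLinear` can be replaced by its affine piece in
integrals. -/
lemma integral_congr_piecewiseLinear (hξ : IsOpenKnotVector T N ξ) (y : ℕ → ℝ) {k : ℕ}
    (hk : 3 ≤ k) (hkN : k ≤ N) {x : ℝ} (hx : x ∈ Icc (ξ k) (ξ (k + 1))) (F : ℝ → ℝ → ℝ) :
    ∫ t in ξ k..x, F t (piecewiseLinear N ξ y t) = ∫ t in ξ k..x, F t (affinePiece ξ y k t) := by
  rw [intervalIntegral.integral_of_le hx.1, intervalIntegral.integral_of_le hx.1,
    integral_Ioc_eq_integral_Ioo, integral_Ioc_eq_integral_Ioo]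
  refine setIntegral_congr_fun measurableSet_Ioo fun t ht => ?_
  rw [piecewiseLinear_of_mem hξ y hk hkN ⟨ht.1.le, ht.2.trans_le hx.2⟩]

lemma integral_piecewiseLinear_of_mem [Fact (0 < T)] (hξ : IsOpenKnotVector T N ξ) (y : ℕ → ℝ)
    {k : ℕ} (hk : 3 ≤ k) (hkN : k ≤ N) {x : ℝ} (hx : x ∈ Icc (ξ k) (ξ (k + 1))) :
    ∫ t in (0 : ℝ)..x, piecewiseLinear N ξ y t = trapSum ξ y k
      + (y k * (x - ξ k) + (y (k + 1) - y k) / (ξ (k + 1) - ξ k) * ((x - ξ k) ^ 2 / 2)) := by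
  have hstep : ∀ k, 3 ≤ k → k ≤ N → ∀ x ∈ Icc (ξ k) (ξ (k + 1)),
      ∫ t in (0 : ℝ)..x, piecewiseLinear N ξ y t = (∫ t in (0 : ℝ)..ξ k, piecewiseLinear N ξ y t)
      + (y k * (x - ξ k) + (y (k + 1) - y k) / (ξ (k + 1) - ξ k) * ((x - ξ k) ^ 2 / 2)) := by
    intro k hk hkN x hx
    have m1 := hξ.mem_Icc (k := k) (by omega) (by omega)
    have m2 := hξ.mem_Icc (k := k + 1) (by omega) (by omega)
    have m3 : x ∈ Icc 0 T := ⟨m1.1.trans hx.1, hx.2.trans m2.2⟩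
    rw [← integral_affinePiece, ← integral_congr_piecewiseLinear hξ y hk hkN hx fun _ z => z]
    exact (intervalIntegral.integral_add_adjacent_intervals
      ((intervalIntegrable_piecewiseLinear T N ξ y).mono_set (uIcc_zero_subset m1))
      ((intervalIntegrable_piecewiseLinear T N ξ y).mono_set (uIcc_subset_of_mem m1 m3))).symm
  have hknot : ∀ k, 3 ≤ k → k ≤ N →
      ∫ t in (0 : ℝ)..ξ k, piecewiseLinear N ξ y t = trapSum ξ y k := by
    intro k hk
    induction k, hk using Nat.le_induction with
    | base => intro _; rw [trapSum_three hξ, hξ.three, intervalIntegral.integral_same]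
    | succ n hn ih =>
      intro hN
      have hlt := hξ.lt_succ hn (by omega)
      rw [hstep n hn (by omega) _ ⟨hlt.le, le_rfl⟩, ih (by omega), trapSum_succ ξ y (by omega)]
      have : ξ (n + 1) - ξ n ≠ 0 := by linarith
      field_simp
      ring
  rw [hstep k hk hkN x hx, hknot k hk hkN]

/-- The primitive of a continuous piecewise linear function is a quadratic spline. -/
lemma primLeft_plL2_mem [hT : Fact (0 < T)] (hξ : IsOpenKnotVector T N ξ) (y : ℕ → ℝ) :
    primLeft (plL2 T N ξ y) ∈ splineLeft T N ξ := by
  have hpos := hT.out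
  show H1Left.toFun T (primLeft (plL2 T N ξ y)) ∈ splineSpace T N ξ
  have hprim : ∀ t : Icc (0 : ℝ) T, prim (plL2 T N ξ y) t
      = ∫ s in (0 : ℝ)..t, piecewiseLinear N ξ y s := by
    intro t
    rw [prim_apply]
    refine intervalIntegral.integral_congr_ae ?_
    filter_upwards [ae_of_ae_Ioo (memLp_piecewiseLinear T N ξ y).coeFn_toLp] with s hs hm
    exact hs (uIoc_subset_uIoc_of_uIcc_subset_uIcc (uIcc_zero_subset t.2) hm)
  have hval : ∀ t (ht : t ∈ Ico 0 T), ext T (prim (plL2 T N ξ y)) t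
      = ∑ i ∈ Finset.Icc 1 N, splineCoeff ξ y i * coxDeBoor ξ 2 i t := by
    intro t ht
    obtain ⟨k, hk, hkN, hmem⟩ := hξ.exists_mem_Ico ht
    rw [ext_apply _ (Ico_subset_Icc_self ht), hprim, sum_splineCoeff_of_mem hξ y hk hkN hmem]
    exact integral_piecewiseLinear_of_mem hξ y hk hkN (Ico_subset_Icc_self hmem)
  have e : H1Left.toFun T (primLeft (plL2 T N ξ y))
      = ∑ i ∈ Finset.Icc 1 N, splineCoeff ξ y i • bSpline T ξ 2 i := by
    funext t
    show prim (plL2 T N ξ y) t = _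
    rw [Finset.sum_apply, ← ext_apply (prim (plL2 T N ξ y)) t.2]
    simp only [Pi.smul_apply, smul_eq_mul, bSpline]
    rcases eq_or_ne (t : ℝ) T with h | h
    · simp only [h, if_true]
      -- At the right endpoint both sides are limits of their values to the left of it.
      have hlim : ∀ i, Filter.Tendsto (coxDeBoor ξ 2 i) (nhdsWithin T (Iio T))
          (nhds (Function.leftLim (coxDeBoor ξ 2 i) T)) := fun i => by
        obtain ⟨l, hl⟩ := exists_tendsto_coxDeBoor ξ 2 i T
        rwa [leftLim_eq_of_tendsto hl]
      have h1 := tendsto_finsetSum (Finset.Icc 1 N)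
        fun i _ => (hlim i).const_mul (splineCoeff ξ y i)
      have h2 : Filter.Tendsto (ext T (prim (plL2 T N ξ y))) (nhdsWithin T (Iio T))
          (nhds (ext T (prim (plL2 T N ξ y)) T)) :=
        ((continuous_ext _).tendsto T).mono_left nhdsWithin_le_nhds
      refine tendsto_nhds_unique h2 (h1.congr' ?_)
      filter_upwards [Ioo_mem_nhdsLT hpos] with s hs
      exact (hval s ⟨hs.1.le, hs.2⟩).symm
    · simp only [h, if_false]
      exact hval t ⟨t.2.1, lt_of_le_of_ne t.2.2 h⟩
  rw [e]
  refine Submodule.sum_mem _ fun i hi => Submodule.smul_mem _ _ (Submodule.subset_span ?_)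
  exact ⟨i, Finset.mem_Icc.1 hi, rfl⟩

end Splines

/-! ### The interpolation error -/

/-- The error of linear interpolation for a function whose derivative is Hölder continuous of
order `1/2`. -/
lemma sq_sub_linear_interpolant_le {U w : ℝ → ℝ} (hU : ∀ x, HasDerivAt U (w x) x) {a b M : ℝ}
    (hab : a < b) (hw : ∀ r s, a ≤ r → r ≤ s → s ≤ b → (w s - w r) ^ 2 ≤ (s - r) * M) {t : ℝ}
    (ht : t ∈ Icc a b) :
    (U t - (U a + (U b - U a) / (b - a) * (t - a))) ^ 2
      ≤ ((t - a) * (b - t)) ^ 2 / (b - a) * M := by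
  have hba : b - a ≠ 0 := by linarith
  -- Apply the mean value theorem on both sides of `t` and compare the two slopes.
  rcases eq_or_lt_of_le ht.1 with rfl | h1
  · simp
  rcases eq_or_lt_of_le ht.2 with rfl | h2
  · simp [hba]
  have hUc : Continuous U := continuous_iff_continuousAt.2 fun x => (hU x).continuousAt
  obtain ⟨c, hc, hc'⟩ := exists_hasDerivAt_eq_slope U w h1 hUc.continuousOn fun x _ => hU x
  obtain ⟨d, hd, hd'⟩ := exists_hasDerivAt_eq_slope U w h2 hUc.continuousOn fun x _ => hU x
  have hM : 0 ≤ M := by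
    have := (sq_nonneg _).trans (hw a b le_rfl hab.le le_rfl)
    exact nonneg_of_mul_nonneg_right this (by linarith)
  have hcd := hw c d hc.1.le (hc.2.trans hd.1).le hd.2.le
  have hle : (w d - w c) ^ 2 ≤ (b - a) * M :=
    hcd.trans (mul_le_mul_of_nonneg_right (by linarith [hc.1, hd.2]) hM)
  have e : U t - (U a + (U b - U a) / (b - a) * (t - a))
      = -((t - a) * (b - t) / (b - a) * (w d - w c)) := by
    have n1 : t - a ≠ 0 := by linarith
    have n2 : b - t ≠ 0 := by linarith
    rw [hc', hd']
    field_simp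
    ring
  rw [e, neg_sq, mul_pow]
  calc ((t - a) * (b - t) / (b - a)) ^ 2 * (w d - w c) ^ 2
      ≤ ((t - a) * (b - t) / (b - a)) ^ 2 * ((b - a) * M) :=
        mul_le_mul_of_nonneg_left hle (sq_nonneg _)
    _ = _ := by field_simp

/-- The square of the `L²` norm of the weight in `sq_sub_linear_interpolant_le`. -/
lemma integral_sq_mul_sub (a b : ℝ) :
    ∫ t in a..b, ((t - a) * (b - t)) ^ 2 = (b - a) ^ 5 / 30 := by
  have h : ∀ t, HasDerivAt (fun t => (b - a) ^ 2 * ((t - a) ^ 3 / 3)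
      - (b - a) * ((t - a) ^ 4 / 2) + (t - a) ^ 5 / 5) (((t - a) * (b - t)) ^ 2) t := by
    intro t
    have h1 := (hasDerivAt_id t).sub_const a
    convert! ((((h1.pow 3).div_const 3).const_mul ((b - a) ^ 2)).sub
      (((h1.pow 4).div_const 2).const_mul (b - a))).add ((h1.pow 5).div_const 5) using 1
    simp only [id]
    push_cast
    ring
  rw [intervalIntegral.integral_eq_sub_of_hasDerivAt (fun t _ => h t)
    (by apply Continuous.intervalIntegrable; fun_prop)]
  ring

section Galerkin

variable {T : ℝ} [hT : Fact (0 < T)] {N : ℕ} {ξ : ℕ → ℝ}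

/-- The twofold primitive `J² g` is approximated to second order in the mesh-size by derivatives of
quadratic splines, namely by its continuous piecewise linear interpolant. -/
lemma exists_norm_JJ_sub_le (hξ : IsOpenKnotVector T N ξ) (g : L2 T) :
    ∃ y, ‖J T (J T g) - plL2 T N ξ y‖ ≤ meshSize N ξ ^ 2 / 5 * ‖g‖ := by
  set h := meshSize N ξ with hh
  have hw := continuous_ext (T := T) (prim g)
  set U : ℝ → ℝ := fun s => ∫ r in (0 : ℝ)..s, ext T (prim g) r with hU
  have hUd : ∀ s, HasDerivAt U (ext T (prim g) s) s := fun s =>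
    intervalIntegral.integral_hasDerivAt_right (hw.intervalIntegrable _ _)
      (hw.stronglyMeasurableAtFilter _ _) hw.continuousAt
  have hUc : Continuous U := continuous_iff_continuousAt.2 fun x => (hUd x).continuousAt
  set y : ℕ → ℝ := fun k => U (ξ k) with hy
  refine ⟨y, ?_⟩
  have hae : ∀ᵐ s, s ∈ uIoc 0 T →
      (J T (J T g) - plL2 T N ξ y : L2 T) s = U s - piecewiseLinear N ξ y s := by
    filter_upwards [ae_of_ae_Ioo (Lp.coeFn_sub (J T (J T g)) (plL2 T N ξ y)),
      ae_of_ae_Ioo (ofCont_coe (prim (J T g))),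
      ae_of_ae_Ioo (memLp_piecewiseLinear T N ξ y).coeFn_toLp] with s h1 h2 h3 hm
    have hm' : s ∈ Icc 0 T := by
      rw [uIoc_of_le hT.out.le] at hm
      exact Ioc_subset_Icc_self hm
    rw [h1 hm, Pi.sub_apply, J_apply (J T g), h2 hm, plL2, h3 hm, ext_apply _ hm', prim_J]
  have hnorm : ‖J T (J T g) - plL2 T N ξ y‖ ^ 2
      = ∫ t in (0 : ℝ)..T, (U t - piecewiseLinear N ξ y t) ^ 2 := by
    rw [L2.norm_sq_eq]
    refine intervalIntegral.integral_congr_ae ?_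
    filter_upwards [hae] with s hs hm
    rw [hs hm]
  have hint : IntervalIntegrable (fun t => (U t - piecewiseLinear N ξ y t) ^ 2) volume 0 T := by
    refine (L2.intervalIntegrable_sq (J T (J T g) - plL2 T N ξ y)).congr_ae ?_
    rw [Filter.EventuallyEq, ae_restrict_iff' measurableSet_uIoc]
    filter_upwards [hae] with s hs hm
    rw [hs hm]
  have hmem : ∀ k ∈ Ico 3 (N + 1), ξ k ∈ Icc 0 T ∧ ξ (k + 1) ∈ Icc 0 T := fun k hk =>
    ⟨hξ.mem_Icc (by have := hk.1; omega) (by have := hk.2; omega),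
      hξ.mem_Icc (by omega) (by have := hk.2; omega)⟩
  have hsub : ∀ k ∈ Ico 3 (N + 1), uIcc (ξ k) (ξ (k + 1)) ⊆ uIcc 0 T := fun k hk =>
    uIcc_subset_of_mem (hmem k hk).1 (hmem k hk).2
  have h3N : 3 ≤ N + 1 := hξ.three_le.trans (Nat.le_succ N)
  have s1 := intervalIntegral.sum_integral_adjacent_intervals_Ico h3N
    fun k hk => hint.mono_set (hsub k hk)
  have s2 := intervalIntegral.sum_integral_adjacent_intervals_Ico h3N
    fun k hk => (L2.intervalIntegrable_sq g).mono_set (hsub k hk)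
  rw [hξ.three, hξ.last₁] at s1 s2
  have hloc : ∀ k ∈ Finset.Ico 3 (N + 1),
      ∫ t in ξ k..ξ (k + 1), (U t - piecewiseLinear N ξ y t) ^ 2
        ≤ h ^ 4 / 30 * ∫ t in ξ k..ξ (k + 1), g t ^ 2 := by
    intro k hk
    rw [Finset.mem_Ico] at hk
    obtain ⟨m1, m2⟩ := hmem k hk
    have hlt := hξ.lt_succ hk.1 (by omega)
    set M := ∫ t in ξ k..ξ (k + 1), g t ^ 2 with hM
    have hM0 : 0 ≤ M := intervalIntegral.integral_nonneg hlt.le fun _ _ => sq_nonneg _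
    have hHolder : ∀ r s, ξ k ≤ r → r ≤ s → s ≤ ξ (k + 1) →
        (ext T (prim g) s - ext T (prim g) r) ^ 2 ≤ (s - r) * M := by
      intro r s hr hrs hs
      refine (sq_prim_sub_le g ⟨m1.1.trans hr, (hrs.trans hs).trans m2.2⟩
        ⟨(m1.1.trans hr).trans hrs, hs.trans m2.2⟩ hrs).trans ?_
      refine mul_le_mul_of_nonneg_left ?_ (by linarith)
      exact intervalIntegral.integral_mono_interval hr hrs hs
        (Filter.Eventually.of_forall fun _ => sq_nonneg _)
        ((L2.intervalIntegrable_sq g).mono_set (hsub k hk))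
    rw [integral_congr_piecewiseLinear hξ y hk.1 (by omega) ⟨hlt.le, le_rfl⟩
      fun t z => (U t - z) ^ 2]
    have hle : ∫ t in ξ k..ξ (k + 1), (U t - affinePiece ξ y k t) ^ 2
        ≤ ∫ t in ξ k..ξ (k + 1),
          ((t - ξ k) * (ξ (k + 1) - t)) ^ 2 * (M / (ξ (k + 1) - ξ k)) := by
      refine intervalIntegral.integral_mono_on hlt.le
        (((hUc.sub (continuous_affinePiece ξ y k)).pow 2).intervalIntegrable _ _)
        (by apply Continuous.intervalIntegrable; fun_prop) fun t ht => ?_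
      refine (sq_sub_linear_interpolant_le hUd hlt hHolder ht).trans_eq ?_
      ring
    refine hle.trans ?_
    rw [intervalIntegral.integral_mul_const, integral_sq_mul_sub]
    have hℓ : ξ (k + 1) - ξ k ≤ h :=
      sub_le_meshSize ξ (by omega) (by omega)
    have hpos : 0 < ξ (k + 1) - ξ k := by linarith
    calc (ξ (k + 1) - ξ k) ^ 5 / 30 * (M / (ξ (k + 1) - ξ k))
        = (ξ (k + 1) - ξ k) ^ 4 / 30 * M := by field_simp
      _ ≤ h ^ 4 / 30 * M := by gcongr
  refine le_of_sq_le_sq ?_ (by positivity)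
  calc ‖J T (J T g) - plL2 T N ξ y‖ ^ 2 ≤ h ^ 4 / 30 * ‖g‖ ^ 2 := by
        rw [hnorm, L2.norm_sq_eq g, ← s1, ← s2, Finset.mul_sum]
        exact Finset.sum_le_sum hloc
    _ ≤ h ^ 4 / 25 * ‖g‖ ^ 2 := by gcongr; norm_num
    _ = (h ^ 2 / 5 * ‖g‖) ^ 2 := by ring

/-! ### Stability of the Galerkin method -/

lemma toFun_injective : Function.Injective (H1Left.toFun T) := fun _ _ h =>
  Subtype.ext (Subtype.ext (DFunLike.coe_injective h))

instance : FiniteDimensional ℝ (splineLeft T N ξ) := by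
  have : FiniteDimensional ℝ (splineSpace T N ξ) :=
    FiniteDimensional.span_of_finite ℝ ((finite_Icc 1 N).image _)
  refine Module.Finite.of_injective
    ((H1Left.toFun T).restrict (p := splineLeft T N ξ) (q := splineSpace T N ξ) fun _ h => h) ?_
  intro u v h
  exact Subtype.ext (toFun_injective (congrArg Subtype.val h))

/-- The discrete inf-sup condition for quadratic splines: to `u` belongs a test function of norm at
most `L ‖u‖`, where `L = 1 + √μ T / 2`. -/
lemma exists_spline_infSup (hξ : IsOpenKnotVector T N ξ) {μ : ℝ} (hμ : 0 < μ)
    (u : splineLeft T N ξ) :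
    ∃ v : splineLeft T N ξ, ‖v‖ ≤ (1 + √μ * T / 2) * ‖u‖ ∧
      (1 - μ * (meshSize N ξ ^ 2 / 5) * (1 + √μ * T / 2)) * ‖u‖ ^ 2
        ≤ galerkinForm T μ (splineLeft T N ξ) u v := by
  obtain ⟨B, hBA, -, hB⟩ := exists_inverse_opA (T := T) (Real.sqrt_pos.2 hμ)
  rw [Real.sq_sqrt hμ.le] at hBA
  obtain ⟨w, hw, hwL, hle⟩ := exists_discrete_infSup
    ((splineLeft T N ξ).map (H1Left.deriv T)) (K := J T * J T)
    (ε := meshSize N ξ ^ 2 / 5) hμ.le (opA_apply μ) hBA hB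
    (fun g => by
      obtain ⟨y, hy⟩ := exists_norm_JJ_sub_le hξ g
      refine ⟨plL2 T N ξ y, ?_, hy⟩
      rw [← deriv_primLeft (plL2 T N ξ y)]
      exact Submodule.mem_map_of_mem (primLeft_plL2_mem hξ y))
    (H1Left.deriv T u) (Submodule.mem_map_of_mem u.2)
  obtain ⟨v, hv, rfl⟩ := Submodule.mem_map.1 hw
  rw [← a_HT] at hle
  exact ⟨⟨v, hv⟩, hwL, hle⟩

/-- A bilinear form on a finite-dimensional space that satisfies an inf-sup condition defines a
uniquely solvable and stable problem. -/
lemma existsUnique_and_norm_le_of_infSup {V : Type*} [NormedAddCommGroup V] [NormedSpace ℝ V]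
    [FiniteDimensional ℝ V] {b : V →ₗ[ℝ] V →ₗ[ℝ] ℝ} {κ L : ℝ} (hL : 0 ≤ L) (hκ : 0 < κ)
    (h : ∀ u, ∃ v, ‖v‖ ≤ L * ‖u‖ ∧ κ * ‖u‖ ^ 2 ≤ b u v) :
    (∀ F : V →ₗ[ℝ] ℝ, ∃! u, ∀ v, b u v = F v) ∧
      ∀ (F : V →ₗ[ℝ] ℝ) (C : ℝ) (u : V), 0 ≤ C → (∀ v, |F v| ≤ C * ‖v‖) →
        (∀ v, b u v = F v) → ‖u‖ ≤ L / κ * C := by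
  have hstab : ∀ (F : V →ₗ[ℝ] ℝ) (C : ℝ) (u : V), 0 ≤ C → (∀ v, |F v| ≤ C * ‖v‖) →
      (∀ v, b u v = F v) → ‖u‖ ≤ L / κ * C := by
    intro F C u hC hF hu
    obtain ⟨v, hv, hle⟩ := h u
    rcases eq_or_lt_of_le (norm_nonneg u) with h0 | hpos
    · rw [← h0]
      positivity
    · have h1 : κ * ‖u‖ ^ 2 ≤ C * (L * ‖u‖) :=
        hle.trans (((hu v).trans_le (le_abs_self _)).trans
          ((hF v).trans (mul_le_mul_of_nonneg_left hv hC)))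
      have h2 : κ * ‖u‖ ≤ L * C := by nlinarith
      rw [div_mul_eq_mul_div, le_div_iff₀ hκ, mul_comm]
      exact h2
  refine ⟨fun F => ?_, hstab⟩
  have hinj : Function.Injective b := by
    refine (injective_iff_map_eq_zero _).2 fun u hu => ?_
    have := hstab 0 0 u le_rfl (by simp) (by simp [hu])
    rw [mul_zero] at this
    exact norm_le_zero_iff.1 this
  have hsurj : Function.Surjective b :=
    (LinearMap.injective_iff_surjective_of_finrank_eq_finrank
      (Subspace.dual_finrank_eq (K := ℝ) (V := V)).symm).1 hinj
  obtain ⟨u, hu⟩ := hsurj F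
  refine ⟨u, fun v => by rw [hu], fun w hw => hinj ?_⟩
  exact (LinearMap.ext hw).trans hu.symm

/-! ### The constants -/

lemma constants_aux {x q κ : ℝ} (hx : 0 < x) (hq : 1 + 0.4 * x ^ 2 ≤ q) (hκ : 0.29 ≤ κ)
    (hκ' : x ≤ 1 → 0.7 ≤ κ) :
    1 ≤ κ * ((2 + x) * q) ∧ 1 + x ^ 2 / 2 ≤ κ * ((2 + x) * q ^ 2) := by
  have hx2 := sq_nonneg x
  have hq2 : 1 + 0.8 * x ^ 2 ≤ q ^ 2 := by
    have := pow_le_pow_left₀ (by positivity) hq 2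
    nlinarith
  have hκ0 : 0 ≤ κ := by linarith
  rcases le_total x 1 with h1 | h1
  · have h2 : 2 * (1 + 0.4 * x ^ 2) ≤ (2 + x) * q :=
      mul_le_mul (by linarith) hq (by positivity) (by linarith)
    have h3 : 2 * (1 + 0.8 * x ^ 2) ≤ (2 + x) * q ^ 2 :=
      mul_le_mul (by linarith) hq2 (by positivity) (by linarith)
    have h4 := mul_le_mul (hκ' h1) h2 (by positivity) hκ0
    have h5 := mul_le_mul (hκ' h1) h3 (by positivity) hκ0
    constructor <;> linarith
  · have h2 : 3 * (1 + 0.4 * x ^ 2) ≤ (2 + x) * q :=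
      mul_le_mul (by linarith) hq (by positivity) (by linarith)
    have h3 : 3 * (1 + 0.8 * x ^ 2) ≤ (2 + x) * q ^ 2 :=
      mul_le_mul (by linarith) hq2 (by positivity) (by linarith)
    have h4 := mul_le_mul hκ h2 (by positivity) hκ0
    have h5 := mul_le_mul hκ h3 (by positivity) hκ0
    have h6 : 1 ≤ x ^ 2 := one_le_pow₀ h1
    constructor <;> linarith

/-- Put `x = √μ T`. Here `L = 1 + x / 2` is the stability constant of the continuous problem, and
`L / κ` with `κ = 1 - μ L h² / 5` is that of the discrete problem. The mesh condition gives
`κ ≥ 0.29`, which suffices if `x ≥ 1`; for smaller `x` the bound `h ≤ T` gives `κ ≥ 0.7`. -/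
lemma constants_le {T μ h : ℝ} (hT : 0 < T) (hμ : 0 < μ) (h0 : 0 ≤ h) (hhT : h ≤ T)
    (hh : h ≤ Real.pi ^ 2 / (√2 * (2 + √μ * T) * μ * T)) :
    0 < 1 - μ * (h ^ 2 / 5) * (1 + √μ * T / 2) ∧
    (1 + √μ * T / 2) / (1 - μ * (h ^ 2 / 5) * (1 + √μ * T / 2))
      ≤ (2 + √μ * T) ^ 2 * (Real.pi ^ 2 + 4 * μ * T ^ 2) / (2 * Real.pi ^ 2) ∧
    (1 + √μ * T / 2) / (1 - μ * (h ^ 2 / 5) * (1 + √μ * T / 2)) * (1 + μ * T ^ 2 / 2)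
      ≤ (2 + √μ * T) ^ 2 * (Real.pi ^ 2 + 4 * μ * T ^ 2) ^ 2 / (2 * Real.pi ^ 4) := by
  set x := √μ * T with hx
  have hx0 : 0 < x := mul_pos (Real.sqrt_pos.2 hμ) hT
  have hxx : μ * T ^ 2 = x ^ 2 := by rw [hx, mul_pow, Real.sq_sqrt hμ.le]
  have hpi0 := Real.pi_pos
  have hpi : Real.pi ^ 2 ≤ 10 := by nlinarith [Real.pi_lt_d2, Real.pi_pos]
  have hs : (1.41 : ℝ) ≤ √2 := Real.le_sqrt_of_sq_le (by norm_num)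
  set q := 1 + 4 * x ^ 2 / Real.pi ^ 2 with hq
  have hq1 : 1 + 0.4 * x ^ 2 ≤ q := by
    have : 0.4 * x ^ 2 ≤ 4 * x ^ 2 / Real.pi ^ 2 := by
      rw [le_div_iff₀ (by positivity)]
      nlinarith [sq_nonneg x]
    linarith
  set κ := 1 - μ * (h ^ 2 / 5) * (1 + x / 2) with hκ
  have hκ1 : 0.29 ≤ κ := by
    rw [le_div_iff₀ (by positivity)] at hh
    have hm : 0 ≤ h * ((2 + x) * μ * T) := by positivity
    have h1 : h * ((2 + x) * μ * T) ≤ 7.1 := by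
      have : 1.41 * (h * ((2 + x) * μ * T)) ≤ 10 := by
        calc 1.41 * (h * ((2 + x) * μ * T)) ≤ √2 * (h * ((2 + x) * μ * T)) := by gcongr
          _ = h * (√2 * (2 + x) * μ * T) := by ring
          _ ≤ 10 := hh.trans hpi
      linarith
    have h2 : h * ((2 + x) * μ * h) ≤ h * ((2 + x) * μ * T) := by gcongr
    rw [hκ]
    linarith
  have hκ2 : x ≤ 1 → 0.7 ≤ κ := by
    intro hx1
    have h1 : h ^ 2 ≤ T ^ 2 := by gcongr
    have h2 : μ * h ^ 2 * (2 + x) ≤ x ^ 2 * 3 := by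
      rw [← hxx]
      gcongr
      linarith
    rw [hκ]
    nlinarith
  have hκ0 : 0 < κ := by linarith
  obtain ⟨c1, c2⟩ := constants_aux hx0 hq1 hκ1 hκ2
  refine ⟨hκ0, ?_, ?_⟩
  · have e : (2 + x) ^ 2 * (Real.pi ^ 2 + 4 * μ * T ^ 2) / (2 * Real.pi ^ 2)
        = (1 + x / 2) * ((2 + x) * q) := by
      rw [mul_assoc 4 μ, hxx, hq]
      field_simp
    rw [e, div_le_iff₀ hκ0]
    nlinarith
  · have e : (2 + x) ^ 2 * (Real.pi ^ 2 + 4 * μ * T ^ 2) ^ 2 / (2 * Real.pi ^ 4)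
        = (1 + x / 2) * ((2 + x) * q ^ 2) := by
      rw [mul_assoc 4 μ, hxx, hq]
      field_simp
    rw [e, hxx, div_mul_eq_mul_div, div_le_iff₀ hκ0]
    nlinarith

/-! ### The continuous problem and quasi-optimality -/

variable (T) in
/-- The isometry `v ↦ H_T v`. -/
def HTIsometry : H1Left T →ₗᵢ[ℝ] H1Right T := ⟨HT T, norm_HT⟩

lemma abs_apply_HT_le (f : StrongDual ℝ (H1Right T)) (v : H1Left T) :
    |f (HT T v)| ≤ ‖f‖ * ‖v‖ := by
  rw [← norm_HT v]
  exact f.le_opNorm _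

lemma abs_a_HT_le {μ : ℝ} (hμ : 0 ≤ μ) (u v : H1Left T) :
    |a T μ u (HT T v)| ≤ (1 + μ * T ^ 2 / 2) * ‖u‖ * ‖v‖ := by
  rw [a_HT]
  exact (abs_real_inner_le_norm _ _).trans
    (mul_le_mul_of_nonneg_right (norm_opA_apply_le hμ _) (norm_nonneg _))

/-- The continuous problem has exactly one solution. -/
lemma existsUnique_isSolution {μ : ℝ} (hμ : 0 < μ) (f : StrongDual ℝ (H1Right T)) :
    ∃ u, IsSolution T μ f u ∧ ∀ w, IsSolution T μ f w → w = u := by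
  obtain ⟨B, hBA, hAB, -⟩ := exists_inverse_opA (T := T) (Real.sqrt_pos.2 hμ)
  rw [Real.sq_sqrt hμ.le] at hBA hAB
  let φ : StrongDual ℝ (L2 T) :=
    f ∘L (HTIsometry T).toContinuousLinearMap ∘L
      ((derivEquiv T).symm.toContinuousLinearEquiv : L2 T →L[ℝ] H1Left T)
  set F := (InnerProductSpace.toDual ℝ (L2 T)).symm φ with hF
  have hφ : ∀ v : H1Left T, inner ℝ F (H1Left.deriv T v) = f (HT T v) := by
    intro v
    rw [hF, InnerProductSpace.toDual_symm_apply]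
    show f (HT T ((derivEquiv T).symm (derivEquiv T v))) = f (HT T v)
    rw [LinearIsometryEquiv.symm_apply_apply]
  have hiff : ∀ u, IsSolution T μ f u ↔ opA T μ (H1Left.deriv T u) = F := by
    intro u
    constructor
    · intro hu
      refine ext_inner_right ℝ fun k => ?_
      have := hu (primLeft k)
      rwa [a_HT, ← hφ, deriv_primLeft] at this
    · intro hu v
      rw [a_HT, hu, hφ]
  refine ⟨primLeft (B F), (hiff _).2 (by rw [deriv_primLeft, hAB]), fun w hw => ?_⟩
  rw [← (hiff w).1 hw, hBA, primLeft_deriv]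

end Galerkin

end IGA

end

theorem mainTheorem2 (T μ : ℝ) [Fact (0 < T)] (hμ : 0 < μ) (N : ℕ) (ξ : ℕ → ℝ)
    (hξ : IGA.IsOpenKnotVector T N ξ)
    (hh : IGA.meshSize N ξ ≤ Real.pi ^ 2 / (√2 * (2 + √μ * T) * μ * T)) :
    IGA.WellPosed (IGA.galerkinForm T μ (IGA.splineLeft T N ξ)) ∧
    ∀ f : StrongDual ℝ (IGA.H1Right T),
      ∃ (u : IGA.H1Left T) (uh : IGA.splineLeft T N ξ),
        (IGA.IsSolution T μ f u ∧ ∀ w, IGA.IsSolution T μ f w → w = u) ∧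
        (IGA.IsGalerkinSolution T μ (IGA.splineLeft T N ξ) f uh ∧
          ∀ w, IGA.IsGalerkinSolution T μ (IGA.splineLeft T N ξ) f w → w = uh) ∧
        ‖uh‖ ≤ (2 + √μ * T) ^ 2 * (Real.pi ^ 2 + 4 * μ * T ^ 2) / (2 * Real.pi ^ 2) * ‖f‖ ∧
        ‖u - uh‖ ≤
          (1 + (2 + √μ * T) ^ 2 * (Real.pi ^ 2 + 4 * μ * T ^ 2) ^ 2 / (2 * Real.pi ^ 4)) *
            ⨅ vh : IGA.splineLeft T N ξ, ‖u - vh‖ := by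
  have hT : 0 < T := Fact.out
  obtain ⟨hκ, hC₁, hC₂⟩ := IGA.constants_le hT hμ (IGA.meshSize_nonneg N ξ) hξ.meshSize_le hh
  set κ := 1 - μ * (IGA.meshSize N ξ ^ 2 / 5) * (1 + √μ * T / 2)
  obtain ⟨hex, hstab⟩ := IGA.existsUnique_and_norm_le_of_infSup (by positivity) hκ
    (IGA.exists_spline_infSup hξ hμ)
  refine ⟨⟨fun F => hex F, (1 + √μ * T / 2) / κ, by positivity, fun F u hu =>
    hstab F ‖F‖ u (ContinuousLinearMap.opNorm_nonneg F) F.le_opNorm hu⟩, fun f => ?_⟩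
  obtain ⟨u, hu, huniq⟩ := IGA.existsUnique_isSolution hμ f
  obtain ⟨uh, huh, huhuniq⟩ := hex
    (f.toLinearMap ∘ₗ IGA.HT T ∘ₗ (IGA.splineLeft T N ξ).subtype)
  refine ⟨u, uh, ⟨hu, huniq⟩, ⟨huh, huhuniq⟩, ?_, ?_⟩
  · refine (hstab _ ‖f‖ uh (norm_nonneg _) (fun v => IGA.abs_apply_HT_le f v) huh).trans ?_
    exact mul_le_mul_of_nonneg_right hC₁ (norm_nonneg _)
  · rw [Real.mul_iInf_of_nonneg (by positivity)]
    refine le_ciInf fun w => ?_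
    -- The difference `uh - w` is the Galerkin solution for the data of `u - w`.
    have hdiff : ‖uh - w‖ ≤ (1 + √μ * T / 2) / κ * ((1 + μ * T ^ 2 / 2) * ‖u - w‖) := by
      refine hstab ((IGA.aHT T μ (u - w)) ∘ₗ (IGA.splineLeft T N ξ).subtype) _ (uh - w)
        (by positivity) (fun v => IGA.abs_a_HT_le hμ.le _ _) fun v => ?_
      have h1 : IGA.a T μ uh (IGA.HT T v) = f (IGA.HT T v) := huh v
      have h2 := hu v
      show IGA.a T μ ((uh - w : IGA.splineLeft T N ξ) : IGA.H1Left T) (IGA.HT T v)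
        = IGA.a T μ (u - w) (IGA.HT T v)
      rw [Submodule.coe_sub, map_sub, map_sub, LinearMap.sub_apply, LinearMap.sub_apply, h1, h2]
    calc ‖u - uh‖ = ‖(u - w) - ((uh - w : IGA.splineLeft T N ξ) : IGA.H1Left T)‖ := by
          rw [Submodule.coe_sub, sub_sub_sub_cancel_right]
      _ ≤ ‖u - w‖ + ‖uh - w‖ := norm_sub_le _ _
      _ ≤ ‖u - w‖ + (1 + √μ * T / 2) / κ * ((1 + μ * T ^ 2 / 2) * ‖u - w‖) := by gcongr
      _ = (1 + (1 + √μ * T / 2) / κ * (1 + μ * T ^ 2 / 2)) * ‖u - w‖ := by ring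
      _ ≤ _ := by gcongr
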